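/- Let $\mathbb D$ be the open unit disc in $\mathbb C$ and write $(x)_n=x(x+1)\cdots(x+n-1)$. For $s>0$ let $A^{(s)}(\mathbb D)$ be the Hilbert space of holomorphic functions on $\mathbb D$ with reproducing kernel $(1-z\bar w)^{-2s}$; the functions $\sqrt{(2s)_n/n!}\,z^n$, $n\ge 0$, form an orthonormal basis of it. Let $m\ge 1$ be an integer, $\lambda>m/2$ a real number, $\lambda_j=\lambda-\frac m2+j$ for $0\le j\le m$, and let $\mu=(\mu_0,\mu_1,\dots,\mu_m)$ with $\mu_0=1$ and $\mu_1,\dots,\mu_m>0$. For $f\in A^{(\lambda_j)}(\mathbb D)$ let $\Gamma_jf:\mathbb D\to\mathbb C^{m+1}$ be the function with components $$(\Gamma_jf)_\ell=\binom{\ell}{j}\frac{1}{(2\lambda_j)_{\ell-j}}f^{(\ell-j)}\quad(j\le\ell\le m),\qquad(\Gamma_jf)_\ell=0\quad(0\le\ell<j).$$ The map $(f_0,\dots,f_m)\mapsto\sum_{j=0}^m\mu_j\Gamma_jf_j$ is injective on $\bigoplus_{j=0}^mA^{(\lambda_j)}(\mathbb D)$; let $\mathbf A^{(\lambda,\mu)}(\mathbb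 D)$ be its image, with the inner product that makes this map unitary, and let $M^{(\lambda,\mu)}$ be the operator $(M^{(\lambda,\mu)}f)(z)=zf(z)$ on $\mathbf A^{(\lambda,\mu)}(\mathbb D)$. Then, for every fixed $m\ge1$, the operators $M^{(\lambda,\mu)}$ are mutually unitarily inequivalent: if $\lambda,\lambda'>m/2$, all $\mu_j,\mu_j'>0$, $\mu_0=\mu_0'=1$, and $M^{(\lambda,\mu)}$ and $M^{(\lambda',\mu')}$ are unitarily equivalent, then $\lambda=\lambda'$ and $\mu=\mu'$. -/

import Mathlib

open Complex
open scoped UnitDisc ENNReal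

noncomputable section

namespace HomogeneousShift

/-! ### Transfer of a Hilbert space structure along an injective linear map -/

section Image

variable {E F : Type*} [NormedAddCommGroup E] [InnerProductSpace ℂ E] [AddCommGroup F] [Module ℂ F]

/-- The image of a Hilbert space `E` under an injective linear map `R` into a vector space `F`,
equipped with the inner product transferred from `E`, that is `⟪R x, R y⟫ = ⟪x, y⟫`. -/
def ImageSpace (R : E →ₗ[ℂ] F) (_hR : Function.Injective R) : Type _ := LinearMap.range R

variable (R : E →ₗ[ℂ] F) (hR : Function.Injective R)

instance : AddCommGroup (ImageSpace R hR) := inferInstanceAs (AddCommGroup (LinearMap.range R))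

instance : Module ℂ (ImageSpace R hR) := inferInstanceAs (Module ℂ (LinearMap.range R))

/-- The inclusion of the image of `R` into the ambient space. -/
def ImageSpace.incl : ImageSpace R hR →ₗ[ℂ] F := (LinearMap.range R).subtype

/-- The linear bijection `R x ↦ x` from the image of `R` onto `E`. -/
def ImageSpace.pull : ImageSpace R hR ≃ₗ[ℂ] E := (LinearEquiv.ofInjective R hR).symm

instance : NormedAddCommGroup (ImageSpace R hR) :=
  NormedAddCommGroup.induced _ E (ImageSpace.pull R hR) (ImageSpace.pull R hR).injective

instance : InnerProductSpace ℂ (ImageSpace R hR) where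
  norm_smul_le c x := by
    change ‖ImageSpace.pull R hR (c • x)‖ ≤ ‖c‖ * ‖ImageSpace.pull R hR x‖
    rw [map_smul, norm_smul]
  inner x y := inner ℂ (ImageSpace.pull R hR x) (ImageSpace.pull R hR y)
  norm_sq_eq_re_inner x := norm_sq_eq_re_inner (𝕜 := ℂ) (ImageSpace.pull R hR x)
  conj_inner_symm x y := inner_conj_symm _ _
  add_left x y z := by rw [map_add, inner_add_left]
  smul_left x y c := by rw [map_smul, inner_smul_left]

/-- The bijection `R x ↦ x` is unitary. -/
def ImageSpace.pullIsometry : ImageSpace R hR ≃ₗᵢ[ℂ] E := ⟨ImageSpace.pull R hR, fun _ => rfl⟩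

instance [CompleteSpace E] : CompleteSpace (ImageSpace R hR) :=
  (ImageSpace.pullIsometry R hR).toIsometryEquiv.completeSpace

end Image

/-! ### The weighted Bergman spaces -/

/-- The Pochhammer symbol `(x)_n = x (x + 1) ⋯ (x + n - 1)`. -/
def poch (x : ℝ) (n : ℕ) : ℝ := (ascPochhammer ℝ n).eval x

/-- The coefficient of the `n`-th member `√((2s)_n / n!) z ^ n` of the orthonormal basis of the
Hilbert space with reproducing kernel `(1 - z w̄) ^ (-2s)`. -/
def basisCoeff (s : ℝ) (n : ℕ) : ℝ := √(poch (2 * s) n / n.factorial)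

lemma poch_pos {x : ℝ} (hx : 0 < x) (n : ℕ) : 0 < poch x n := ascPochhammer_pos n x hx

lemma basisCoeff_pos {s : ℝ} (hs : 0 < s) (n : ℕ) : 0 < basisCoeff s n :=
  Real.sqrt_pos.2 (div_pos (poch_pos (by linarith) n) (by positivity))

lemma basisCoeff_succ {s : ℝ} (hs : 0 < s) (n : ℕ) :
    basisCoeff s (n + 1) = basisCoeff s n * √((2 * s + n) / (n + 1)) := by
  have h := poch_pos (x := 2 * s) (by linarith) n
  rw [basisCoeff, basisCoeff, ← Real.sqrt_mul (by positivity)]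
  congr 1
  rw [poch, ascPochhammer_succ_right]
  simp only [Polynomial.eval_mul, Polynomial.eval_add, Polynomial.eval_X, Polynomial.eval_natCast,
    Nat.factorial_succ, Nat.cast_mul, Nat.cast_add, Nat.cast_one, poch]
  field_simp

lemma summable_basisCoeff {s : ℝ} (hs : 0 < s) {r : ℝ} (hr0 : 0 ≤ r) (hr : r < 1) :
    Summable fun n => basisCoeff s n * r ^ n := by
  rcases hr0.eq_or_lt with rfl | hr0
  · refine summable_of_ne_finset_zero (s := {0}) fun n hn => ?_
    simp [zero_pow (by simpa using hn : n ≠ 0)]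
  have hlim : Filter.Tendsto (fun n : ℕ => √((2 * s + n) / (n + 1)) * r) Filter.atTop
      (nhds (√1 * r)) := by
    refine Filter.Tendsto.mul_const _ ((Real.continuous_sqrt.tendsto _).comp ?_)
    have h := tendsto_add_mul_div_add_mul_atTop_nhds (𝕜 := ℝ) (2 * s) 1 1 one_ne_zero
    simpa [add_comm] using h
  refine summable_of_ratio_test_tendsto_lt_one (l := √1 * r) (by simpa using hr)
    (.of_forall fun n => (mul_pos (basisCoeff_pos hs n) (pow_pos hr0 n)).ne') (hlim.congr fun n => ?_)
  have h1 := basisCoeff_pos hs n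
  rw [Real.norm_of_nonneg (mul_pos (basisCoeff_pos hs _) (pow_pos hr0 _)).le,
    Real.norm_of_nonneg (mul_pos h1 (pow_pos hr0 _)).le, basisCoeff_succ hs]
  field_simp
  ring

/-- The square summable complex sequences. -/
abbrev SqSummable : Type := lp (fun _ : ℕ => ℂ) 2

lemma norm_term_le {s : ℝ} (hs : 0 < s) (a : SqSummable) (z : ℂ) (n : ℕ) :
    ‖a n * basisCoeff s n * z ^ n‖ ≤ ‖a‖ * (basisCoeff s n * ‖z‖ ^ n) := by
  rw [norm_mul, norm_mul, norm_pow, Complex.norm_real, Real.norm_of_nonneg (basisCoeff_pos hs n).le,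
    mul_assoc]
  have := basisCoeff_pos hs n
  gcongr
  exact lp.norm_apply_le_norm two_ne_zero a n

lemma summable_term {s : ℝ} (hs : 0 < s) (a : SqSummable) {z : ℂ} (hz : ‖z‖ < 1) :
    Summable fun n => a n * basisCoeff s n * z ^ n :=
  .of_norm_bounded ((summable_basisCoeff hs (norm_nonneg z) hz).mul_left ‖a‖)
    (norm_term_le hs a z)

/-- The linear map that sends a square summable sequence `a` to the function
`z ↦ ∑ a_n √((2s)_n / n!) z ^ n` on the unit disc. -/
def bergmanSeries (s : ℝ) (hs : 0 < s) : SqSummable →ₗ[ℂ] (𝔻 → ℂ) where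
  toFun a z := ∑' n, a n * basisCoeff s n * (z : ℂ) ^ n
  map_add' a b := by
    funext z
    rw [Pi.add_apply, ← (summable_term hs a z.norm_lt_one).tsum_add
      (summable_term hs b z.norm_lt_one)]
    exact tsum_congr fun n => by simp [add_mul]
  map_smul' c a := by
    funext z
    simp only [RingHom.id_apply, Pi.smul_apply, smul_eq_mul]
    rw [← tsum_mul_left]
    exact tsum_congr fun n => by simp [mul_assoc]

/-- The extension by zero of a function on the unit disc. -/
def extend (f : 𝔻 → ℂ) (w : ℂ) : ℂ := if h : ‖w‖ < 1 then f (UnitDisc.mk w h) else 0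

/-- The `k`-th complex derivative of a function on the unit disc. -/
def discDeriv (k : ℕ) (f : 𝔻 → ℂ) (z : 𝔻) : ℂ := iteratedDeriv k (extend f) z

lemma discDeriv_zero (f : 𝔻 → ℂ) (z : 𝔻) : discDeriv 0 f z = f z := by
  simp [discDeriv, extend, z.norm_lt_one]

lemma hasFPowerSeriesOnBall_bergmanSeries {s : ℝ} (hs : 0 < s) (a : SqSummable) :
    HasFPowerSeriesOnBall (extend (bergmanSeries s hs a))
      (FormalMultilinearSeries.ofScalars ℂ fun n => a n * (basisCoeff s n : ℂ)) 0 1 := by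
  set p := FormalMultilinearSeries.ofScalars ℂ fun n => a n * (basisCoeff s n : ℂ) with hp
  have hrad : 1 ≤ p.radius := by
    refine ENNReal.le_of_forall_nnreal_lt fun r hr => ?_
    refine p.le_radius_of_summable_norm ?_
    have hr1 : (r : ℝ) < 1 := by exact_mod_cast hr
    refine .of_nonneg_of_le (fun n => by positivity) (fun n => ?_)
      ((summable_basisCoeff hs r.coe_nonneg hr1).mul_left ‖a‖)
    have h := norm_term_le hs a (r : ℂ) n
    rw [norm_mul, norm_pow] at h
    simpa [hp, FormalMultilinearSeries.ofScalars_norm] using h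
  refine ((p.hasFPowerSeriesOnBall (zero_lt_one.trans_le hrad)).mono zero_lt_one hrad).congr ?_
  intro w hw
  have hw1 : ‖w‖ < 1 := by
    rw [Metric.mem_eball, edist_zero_right] at hw
    simpa [enorm, ← NNReal.coe_lt_coe] using hw
  simp only [extend, hw1, dif_pos, FormalMultilinearSeries.sum, hp,
    FormalMultilinearSeries.ofScalars_apply_eq, bergmanSeries, LinearMap.coe_mk, AddHom.coe_mk,
    UnitDisc.coe_mk, smul_eq_mul]

lemma analyticAt_bergmanSeries {s : ℝ} (hs : 0 < s) (a : SqSummable) (z : 𝔻) :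
    AnalyticAt ℂ (extend (bergmanSeries s hs a)) z := by
  refine (hasFPowerSeriesOnBall_bergmanSeries hs a).analyticAt_of_mem ?_
  rw [Metric.mem_eball, edist_zero_right]
  simpa [enorm, ← NNReal.coe_lt_coe] using z.norm_lt_one

lemma bergmanSeries_injective {s : ℝ} (hs : 0 < s) : Function.Injective (bergmanSeries s hs) := by
  rw [injective_iff_map_eq_zero]
  intro a ha
  have h := (hasFPowerSeriesOnBall_bergmanSeries hs a).hasFPowerSeriesAt
  have h0 : extend (bergmanSeries s hs a) = 0 := by
    funext w
    simp [extend, ha]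
  rw [h0] at h
  have h1 := h.eq_zero
  ext n
  have h2 := (FormalMultilinearSeries.ofScalars_eq_zero ℂ n).1 (congrFun h1 n)
  have h3 : (basisCoeff s n : ℂ) ≠ 0 := by exact_mod_cast (basisCoeff_pos hs n).ne'
  simpa [h3] using h2

/-- The Hilbert space `A^{(s)}(𝔻)` of holomorphic functions on the unit disc, `s > 0`, with
reproducing kernel `(1 - z w̄) ^ (-2s)`: the functions `√((2s)_n / n!) z ^ n` form an orthonormal
basis of it. -/
abbrev Bergman (s : ℝ) (hs : 0 < s) : Type :=
  ImageSpace (bergmanSeries s hs) (bergmanSeries_injective hs)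

/-- An element of `A^{(s)}(𝔻)` as a function on the unit disc. -/
def Bergman.fn {s : ℝ} {hs : 0 < s} : Bergman s hs →ₗ[ℂ] (𝔻 → ℂ) := ImageSpace.incl _ _

lemma Bergman.fn_injective {s : ℝ} {hs : 0 < s} :
    Function.Injective (Bergman.fn (s := s) (hs := hs)) := Subtype.val_injective

lemma Bergman.analyticAt {s : ℝ} {hs : 0 < s} (f : Bergman s hs) (z : 𝔻) :
    AnalyticAt ℂ (extend (Bergman.fn f)) z := by
  obtain ⟨g, a, rfl⟩ := f
  exact analyticAt_bergmanSeries hs a z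

/-- The `k`-th derivative as a linear map on `A^{(s)}(𝔻)`. -/
def Bergman.derivative {s : ℝ} {hs : 0 < s} (k : ℕ) : Bergman s hs →ₗ[ℂ] (𝔻 → ℂ) where
  toFun f := discDeriv k (Bergman.fn f)
  map_add' f g := by
    funext z
    have h : extend (Bergman.fn (f + g)) = extend (Bergman.fn f) + extend (Bergman.fn g) := by
      funext w
      by_cases hw : ‖w‖ < 1 <;> simp [extend, hw]
    rw [Pi.add_apply, discDeriv, h]
    exact iteratedDeriv_add (f.analyticAt z).contDiffAt (g.analyticAt z).contDiffAt
  map_smul' c f := by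
    funext z
    have h : extend (Bergman.fn (c • f)) = c • extend (Bergman.fn f) := by
      funext w
      by_cases hw : ‖w‖ < 1 <;> simp [extend, hw]
    rw [RingHom.id_apply, Pi.smul_apply, discDeriv, h]
    exact iteratedDeriv_const_smul (f.analyticAt z).contDiffAt c

/-! ### The spaces of vector-valued functions -/

/-- The number `λ_j = λ - m / 2 + j`. -/
def lamIdx {m : ℕ} (lam : ℝ) (j : Fin (m + 1)) : ℝ := lam - m / 2 + (j : ℕ)

lemma lamIdx_pos {m : ℕ} {lam : ℝ} (hlam : (m : ℝ) / 2 < lam) (j : Fin (m + 1)) :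
    0 < lamIdx lam j := by
  have : (0 : ℝ) ≤ ((j : ℕ) : ℝ) := Nat.cast_nonneg _
  unfold lamIdx
  linarith

/-- The operator `Γ_j` from `A^{(λ_j)}(𝔻)` to the `ℂ^{m+1}`-valued functions on the disc:
`(Γ_j f)_ℓ = (ℓ choose j) (1 / (2 λ_j)_{ℓ - j}) f^{(ℓ - j)}` for `ℓ ≥ j`, and `0` for `ℓ < j`. -/
def Gam {m : ℕ} {lam : ℝ} (hlam : (m : ℝ) / 2 < lam) (j : Fin (m + 1)) :
    Bergman (lamIdx lam j) (lamIdx_pos hlam j) →ₗ[ℂ] (𝔻 → Fin (m + 1) → ℂ) :=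
  LinearMap.pi fun z => LinearMap.pi fun l =>
    if j ≤ l then
      (((l : ℕ).choose j : ℂ) * (1 / (poch (2 * lamIdx lam j) ((l : ℕ) - j) : ℂ))) •
        (LinearMap.proj z ∘ₗ Bergman.derivative ((l : ℕ) - j))
    else 0

/-- The orthogonal direct sum of the Hilbert spaces `A^{(λ_j)}(𝔻)`, `0 ≤ j ≤ m`. -/
abbrev BergmanSum {m : ℕ} {lam : ℝ} (hlam : (m : ℝ) / 2 < lam) : Type :=
  PiLp 2 fun j : Fin (m + 1) => Bergman (lamIdx lam j) (lamIdx_pos hlam j)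

/-- The map `Γ = ⊕ μ_j Γ_j`, that is `(f_0, …, f_m) ↦ ∑ μ_j Γ_j f_j`. -/
def GamSum {m : ℕ} {lam : ℝ} (hlam : (m : ℝ) / 2 < lam) (mu : Fin (m + 1) → ℝ) :
    BergmanSum hlam →ₗ[ℂ] (𝔻 → Fin (m + 1) → ℂ) :=
  (∑ j, (mu j : ℂ) • (Gam hlam j ∘ₗ LinearMap.proj j)) ∘ₗ
    (WithLp.linearEquiv 2 ℂ _).toLinearMap

lemma GamSum_injective {m : ℕ} {lam : ℝ} (hlam : (m : ℝ) / 2 < lam) {mu : Fin (m + 1) → ℝ}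
    (hmu : ∀ j, 0 < mu j) : Function.Injective (GamSum hlam mu) := by
  rw [injective_iff_map_eq_zero]
  intro f hf
  have key : ∀ n : ℕ, ∀ j : Fin (m + 1), (j : ℕ) = n → f j = 0 := by
    intro n
    induction n using Nat.strong_induction_on with
    | _ n ih =>
      rintro l rfl
      refine Bergman.fn_injective ?_
      rw [map_zero]
      funext z
      have h := congrFun (congrFun hf z) l
      simp only [GamSum, LinearMap.comp_apply, LinearMap.sum_apply, Finset.sum_apply,
        LinearMap.smul_apply, Pi.smul_apply, LinearMap.proj_apply] at h
      rw [Finset.sum_eq_single l] at h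
      · have hl : (mu l : ℂ) ≠ 0 := by exact_mod_cast (hmu l).ne'
        simpa [Gam, poch, Bergman.derivative, discDeriv_zero, hl] using h
      · intro j _ hj
        rcases lt_or_gt_of_ne hj with hlt | hgt
        · have h0 := ih j hlt j rfl
          have : (WithLp.linearEquiv 2 ℂ _).toLinearMap f j = 0 := h0
          rw [this]
          simp
        · simp [Gam, not_le.2 hgt]
      · simp
  ext j : 1
  exact key j j rfl

/-- The Hilbert space `A^{(λ, μ)}(𝔻)`: the algebraic direct sum of the images of the `Γ_j`, with
the inner product that makes `Γ = ⊕ μ_j Γ_j` unitary, so that the vectors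
`μ_j Γ_j (√((2 λ_j)_n / n!) z ^ n)` form an orthonormal basis. -/
abbrev VecSpace {m : ℕ} {lam : ℝ} (hlam : (m : ℝ) / 2 < lam) {mu : Fin (m + 1) → ℝ}
    (hmu : ∀ j, 0 < mu j) : Type :=
  ImageSpace (GamSum hlam mu) (GamSum_injective hlam hmu)

/-- An element of `A^{(λ, μ)}(𝔻)` as a function on the unit disc. -/
def VecSpace.fn {m : ℕ} {lam : ℝ} {hlam : (m : ℝ) / 2 < lam} {mu : Fin (m + 1) → ℝ}
    {hmu : ∀ j, 0 < mu j} : VecSpace hlam hmu →ₗ[ℂ] (𝔻 → Fin (m + 1) → ℂ) :=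
  ImageSpace.incl _ _

lemma VecSpace.fn_injective {m : ℕ} {lam : ℝ} {hlam : (m : ℝ) / 2 < lam} {mu : Fin (m + 1) → ℝ}
    {hmu : ∀ j, 0 < mu j} : Function.Injective (VecSpace.fn (hlam := hlam) (hmu := hmu)) :=
  Subtype.val_injective

/-- The multiplication operator `M^{(λ, μ)}` on `A^{(λ, μ)}(𝔻)`, `(M f)(z) = z f(z)`, with its
natural domain: all `f` in the space for which `z ↦ z f(z)` is in the space. -/
def mulOp {m : ℕ} {lam : ℝ} (hlam : (m : ℝ) / 2 < lam) {mu : Fin (m + 1) → ℝ}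
    (hmu : ∀ j, 0 < mu j) : VecSpace hlam hmu →ₗ.[ℂ] VecSpace hlam hmu where
  domain :=
    { carrier := {f | ∃ g : VecSpace hlam hmu, ∀ z : 𝔻, VecSpace.fn g z = (z : ℂ) • VecSpace.fn f z}
      add_mem' := by
        rintro f f' ⟨g, hg⟩ ⟨g', hg'⟩
        exact ⟨g + g', fun z => by simp [hg z, hg' z]⟩
      zero_mem' := ⟨0, fun z => by simp⟩
      smul_mem' := by
        rintro c f ⟨g, hg⟩
        exact ⟨c • g, fun z => by simp [hg z, smul_comm c (z : ℂ)]⟩ }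
  toFun :=
    { toFun f := f.2.choose
      map_add' f f' := VecSpace.fn_injective <| funext fun z => by
        have h1 := (f + f').2.choose_spec z
        have h2 := f.2.choose_spec z
        have h3 := f'.2.choose_spec z
        rw [h1, map_add, Pi.add_apply, h2, h3]
        simp
      map_smul' c f := VecSpace.fn_injective <| funext fun z => by
        have h1 := (c • f).2.choose_spec z
        have h2 := f.2.choose_spec z
        rw [h1, RingHom.id_apply, map_smul, Pi.smul_apply, h2]
        simp [smul_comm c (z : ℂ)] }

/-- Unitary equivalence of two operators `S` and `T`: there is a unitary `U` which carries the
domain of `S` onto the domain of `T` and satisfies `U S = T U` there. For everywhere defined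
operators this is the usual relation `U S = T U`. -/
def UnitarilyEquivalent {E F : Type*} [NormedAddCommGroup E] [InnerProductSpace ℂ E]
    [NormedAddCommGroup F] [InnerProductSpace ℂ F] (S : E →ₗ.[ℂ] E) (T : F →ₗ.[ℂ] F) : Prop :=
  ∃ U : E ≃ₗᵢ[ℂ] F, (∀ x, x ∈ S.domain ↔ U x ∈ T.domain) ∧
    ∀ (x : S.domain) (y : T.domain), U x = y → U (S x) = T y

end HomogeneousShift

end

/-! Write M for multiplication by z. In the orthonormal basis, the n-th Taylor coefficient at 0 of
the l-th component is represented by `taylorVec lam mu n l`, and M* sends it to the vector with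
index n - 1, or to 0 if n = 0. Hence ker M*, the wandering space, is spanned by the vectors
`taylorVec lam mu 0 l` with l ≤ m. They are mutually orthogonal, and their squared norms are b_l =
`normSeq lam mu l`. A lift of y is the unique x orthogonal to ker M* with M* x = y. A unitary W that
intertwines the two multiplications carries wandering vectors to wandering vectors and lifts to
lifts. With e_p the normalized wandering vectors and L the lift, its matrix V between the wandering
spaces therefore conjugates all the Gram matrices G_k(p, l) = ⟨L^(k+1) e_p, L e_l⟩ at once
(`map_normLift`, `conjTranspose_mul_gram_mul`).

The lifts are explicit (`isLift_liftVec`). They show that G_k lives on the diagonal l = p + k, and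
that its entry there is a positive multiple of the k-th alternating difference at p of c_p = 2λ - m
+ 2p + ρ_p - ρ_{p+1}, where ρ_r = r² b_{r-1} / b_r for r ≤ m and ρ_{m+1} = 0
(`inner_taylorVec_one_liftVec`). Since c_0 < c_m, the nonzero entries connect all indices
(`eq_of_altDiff_ne_zero`), and this forces V to be diagonal (`diagonal_of_intertwines`). Comparing
diagonals of G_0 then gives equality of the sequences c.

The sequence c determines everything: its sum over 0 ≤ p ≤ m telescopes and gives λ; next come the
ρ_r successively, then the b_r from b_0 = 1, then the μ_j, because b_r is triangular in the μ_j².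

M* is used only in weak form, through the relation `ShiftRel`, so boundedness of M plays no role. -/

noncomputable section

namespace HomogeneousShift

/-! ### Taylor coefficients -/

/-- A power series that sums to zero on the open unit disc has zero coefficients. -/
lemma eq_zero_of_hasSum_pow {c : ℕ → ℂ} (h : ∀ z : 𝔻, HasSum (fun n => c n * (z : ℂ) ^ n) 0) :
    c = 0 := by
  set p := FormalMultilinearSeries.ofScalars ℂ c with hp
  have hrad : 1 ≤ p.radius := by
    refine ENNReal.le_of_forall_nnreal_lt fun r hr => p.le_radius_of_summable_norm ?_
    have hr1 : (r : ℝ) < 1 := by exact_mod_cast hr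
    have hs := (h (UnitDisc.mk (r : ℂ) (by simpa using hr1))).summable.norm
    simpa [hp, FormalMultilinearSeries.ofScalars_norm] using hs
  have h1 : HasFPowerSeriesOnBall (0 : ℂ → ℂ) p 0 1 := by
    refine ((p.hasFPowerSeriesOnBall (zero_lt_one.trans_le hrad)).mono zero_lt_one hrad).congr ?_
    intro w hw
    have hw1 : ‖w‖ < 1 := by
      rw [Metric.mem_eball, edist_zero_right] at hw
      simpa [enorm, ← NNReal.coe_lt_coe] using hw
    have := (h (UnitDisc.mk w hw1)).tsum_eq
    simpa [FormalMultilinearSeries.sum, hp, FormalMultilinearSeries.ofScalars_apply_eq,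
      mul_comm] using this
  have h2 := h1.hasFPowerSeriesAt.eq_zero
  funext n
  exact (FormalMultilinearSeries.ofScalars_eq_zero ℂ n).1 (congrFun h2 n)

lemma iteratedDeriv_bergmanSeries_zero {s : ℝ} (hs : 0 < s) (a : SqSummable) (n : ℕ) :
    iteratedDeriv n (extend (bergmanSeries s hs a)) 0 = n.factorial * (a n * basisCoeff s n) := by
  have h := (hasFPowerSeriesOnBall_bergmanSeries hs a).factorial_smul 1 n
  rw [← iteratedDeriv_eq_iteratedFDeriv] at h
  rw [← h]
  simp

lemma hasSum_discDeriv_bergmanSeries {s : ℝ} (hs : 0 < s) (a : SqSummable) (k : ℕ) (z : 𝔻) :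
    HasSum (fun n => ((n + k).factorial / n.factorial : ℂ) *
      (a (n + k) * basisCoeff s (n + k)) * (z : ℂ) ^ n) (discDeriv k (bergmanSeries s hs a) z) := by
  have hball : ∀ w ∈ Metric.ball (0 : ℂ) 1, AnalyticAt ℂ (extend (bergmanSeries s hs a)) w := by
    intro w hw
    exact analyticAt_bergmanSeries hs a (UnitDisc.mk w (by simpa using hw))
  have hdiff : DifferentiableOn ℂ (iteratedDeriv k (extend (bergmanSeries s hs a)))
      (Metric.ball 0 1) := by
    intro w hw
    rw [iteratedDeriv_eq_iterate]
    exact ((hball w hw).iterated_deriv k).differentiableAt.differentiableWithinAt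
  have h := Complex.hasSum_taylorSeries_on_ball hdiff (z := z) (by simpa using z.norm_lt_one)
  refine (h.congr_fun ?_)
  intro n
  have : iteratedDeriv n (iteratedDeriv k (extend (bergmanSeries s hs a))) 0 =
      (n + k).factorial * (a (n + k) * basisCoeff s (n + k)) := by
    rw [← iteratedDeriv_bergmanSeries_zero hs a (n + k)]
    simp only [iteratedDeriv_eq_iterate, Function.iterate_add_apply]
  rw [this]
  simp only [sub_zero, smul_eq_mul]
  ring

/-! ### Coordinates -/

/-- The coordinate space of `A^{(λ, μ)}(𝔻)` with respect to its orthonormal basis. -/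
abbrev CoordSpace (m : ℕ) : Type := PiLp 2 fun _ : Fin (m + 1) => SqSummable

/-- The coefficient of the basis vector with index `(j, n + l - j)` in the vector representing the
`n`-th Taylor coefficient at `0` of the `l`-th component. -/
def taylorCoef {m : ℕ} (lam : ℝ) (mu : Fin (m + 1) → ℝ) (n l : ℕ) (j : Fin (m + 1)) : ℝ :=
  mu j * (l.choose j / poch (2 * lamIdx lam j) (l - j)) *
    ((n + l - j).factorial / n.factorial) * basisCoeff (lamIdx lam j) (n + l - j)

/-- The vector representing the `n`-th Taylor coefficient at `0` of the `l`-th component. -/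
def taylorVec {m : ℕ} (lam : ℝ) (mu : Fin (m + 1) → ℝ) (n l : ℕ) : CoordSpace m :=
  WithLp.toLp 2 fun j => lp.single 2 (n + l - j) (taylorCoef lam mu n l j : ℂ)

lemma inner_taylorVec {m : ℕ} (lam : ℝ) (mu : Fin (m + 1) → ℝ) (n l : ℕ) (a : CoordSpace m) :
    inner ℂ (taylorVec lam mu n l) a = ∑ j, (taylorCoef lam mu n l j : ℂ) * a j (n + l - j) := by
  rw [PiLp.inner_apply]
  refine Finset.sum_congr rfl fun j _ => ?_
  simp only [taylorVec]
  rw [lp.inner_single_left]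
  simp [mul_comm]

/-- This makes the truncated subtraction `n + l - j` harmless: wherever it could truncate, the
binomial factor is already zero. -/
lemma taylorCoef_of_lt {m : ℕ} (lam : ℝ) (mu : Fin (m + 1) → ℝ) (n : ℕ) {l : ℕ}
    {j : Fin (m + 1)} (h : l < j) : taylorCoef lam mu n l j = 0 := by
  simp [taylorCoef, Nat.choose_eq_zero_of_lt h]

/-- The unitary map from `A^{(λ, μ)}(𝔻)` to its coordinate space. -/
def coordEquiv {m : ℕ} {lam : ℝ} (hlam : (m : ℝ) / 2 < lam) {mu : Fin (m + 1) → ℝ}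
    (hmu : ∀ j, 0 < mu j) : VecSpace hlam hmu ≃ₗᵢ[ℂ] CoordSpace m :=
  (ImageSpace.pullIsometry _ _).trans
    (LinearIsometryEquiv.piLpCongrRight 2 fun _ => ImageSpace.pullIsometry _ _)

lemma ImageSpace.incl_eq {E F : Type*} [NormedAddCommGroup E] [InnerProductSpace ℂ E]
    [AddCommGroup F] [Module ℂ F] (R : E →ₗ[ℂ] F) (hR : Function.Injective R)
    (f : ImageSpace R hR) : ImageSpace.incl R hR f = R (ImageSpace.pull R hR f) := by
  have := LinearEquiv.ofInjective_apply R (h := hR) (ImageSpace.pull R hR f)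
  rw [← this]
  exact congrArg Subtype.val ((LinearEquiv.ofInjective R hR).apply_symm_apply f).symm

lemma hasSum_fn {m : ℕ} {lam : ℝ} (hlam : (m : ℝ) / 2 < lam) {mu : Fin (m + 1) → ℝ}
    (hmu : ∀ j, 0 < mu j) (f : VecSpace hlam hmu) (l : Fin (m + 1)) (z : 𝔻) :
    HasSum (fun n => inner ℂ (taylorVec lam mu n l) (coordEquiv hlam hmu f) * (z : ℂ) ^ n)
      (VecSpace.fn f z l) := by
  have hfn : VecSpace.fn f = GamSum hlam mu (ImageSpace.pull _ _ f) := ImageSpace.incl_eq _ _ f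
  rw [hfn]
  set F := ImageSpace.pull _ _ f with hF
  have hcoord : ∀ j, coordEquiv hlam hmu f j = ImageSpace.pull _ _ (F j) := fun j => rfl
  simp only [GamSum, LinearMap.comp_apply, LinearMap.sum_apply, Finset.sum_apply,
        LinearMap.smul_apply, Pi.smul_apply, LinearMap.proj_apply, inner_taylorVec, Finset.sum_mul]
  refine hasSum_sum fun j _ => ?_
  rcases le_or_gt j l with hjl | hjl
  · have hk : ∀ n : ℕ, n + (l : ℕ) - j = n + ((l : ℕ) - j) := fun n =>
      Nat.add_sub_assoc (by exact_mod_cast hjl) n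
    have hb : Bergman.fn (F j) = bergmanSeries _ (lamIdx_pos hlam j) (coordEquiv hlam hmu f j) := by
      rw [hcoord]
      exact ImageSpace.incl_eq _ _ (F j)
    have h := hasSum_discDeriv_bergmanSeries (lamIdx_pos hlam j) (coordEquiv hlam hmu f j)
      ((l : ℕ) - j) z
    have h2 := h.mul_left ((mu j : ℂ) * (((l : ℕ).choose j : ℂ) *
      (1 / (poch (2 * lamIdx lam j) ((l : ℕ) - j) : ℂ))))
    have hval : (mu j : ℂ) • Gam hlam j ((WithLp.linearEquiv 2 ℂ _).toLinearMap F j) z l =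
        ((mu j : ℂ) * (((l : ℕ).choose j : ℂ) *
      (1 / (poch (2 * lamIdx lam j) ((l : ℕ) - j) : ℂ)))) * discDeriv ((l : ℕ) - j)
        (bergmanSeries _ (lamIdx_pos hlam j) (coordEquiv hlam hmu f j)) z := by
      rw [← hb]
      simp only [Gam, LinearMap.pi_apply, if_pos hjl, smul_eq_mul, LinearMap.smul_apply,
        LinearMap.comp_apply, LinearMap.proj_apply, mul_assoc]
      rfl
    rw [hval]
    refine h2.congr_fun fun n => ?_
    rw [taylorCoef, hk]
    push_cast
    ring
  · have : ∀ n, taylorCoef lam mu n l j = 0 := fun n => taylorCoef_of_lt _ _ _ hjl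
    simp [Gam, not_le.2 hjl, this]

/-- The relation `b = z a` in coordinates. -/
def ShiftRel {m : ℕ} (lam : ℝ) (mu : Fin (m + 1) → ℝ) (a b : CoordSpace m) : Prop :=
  ∀ l ≤ m, inner ℂ (taylorVec lam mu 0 l) b = 0 ∧
    ∀ n, inner ℂ (taylorVec lam mu (n + 1) l) b = inner ℂ (taylorVec lam mu n l) a

lemma shiftRel_coordEquiv_iff {m : ℕ} {lam : ℝ} (hlam : (m : ℝ) / 2 < lam) {mu : Fin (m + 1) → ℝ}
    (hmu : ∀ j, 0 < mu j) (f g : VecSpace hlam hmu) :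
    ShiftRel lam mu (coordEquiv hlam hmu f) (coordEquiv hlam hmu g) ↔
      ∀ z : 𝔻, VecSpace.fn g z = (z : ℂ) • VecSpace.fn f z := by
  constructor
  · intro h z
    funext l
    obtain ⟨h0, h1⟩ := h l (Nat.lt_succ_iff.1 l.2)
    have hf := (hasSum_fn hlam hmu f l z).mul_left (z : ℂ)
    have hg := hasSum_fn hlam hmu g l z
    rw [← hasSum_nat_add_iff' 1] at hg
    simp only [Finset.sum_range_one, h0, h1, zero_mul, sub_zero] at hg
    refine hg.unique (hf.congr_fun fun n => ?_)
    ring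
  · intro h l hl
    set l' : Fin (m + 1) := ⟨l, Nat.lt_succ_of_le hl⟩
    set A : ℕ → ℂ := fun n => inner ℂ (taylorVec lam mu n l) (coordEquiv hlam hmu f)
    set B : ℕ → ℂ := fun n => inner ℂ (taylorVec lam mu n l) (coordEquiv hlam hmu g)
    -- The sequence 0, A 0, A 1, … lists the Taylor coefficients of z f.
    have key : (fun n => B n - Nat.casesOn n 0 A) = 0 := by
      refine eq_zero_of_hasSum_pow fun z => ?_
      have hf := (hasSum_fn hlam hmu f l' z).mul_left (z : ℂ)
      have hg := hasSum_fn hlam hmu g l' z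
      have hf' : HasSum (fun n => (Nat.casesOn n 0 A : ℂ) * (z : ℂ) ^ n)
          ((z : ℂ) * VecSpace.fn f z l') := by
        rw [← hasSum_nat_add_iff' 1]
        rw [Finset.sum_range_one, show (Nat.casesOn 0 0 A : ℂ) = 0 from rfl, zero_mul, sub_zero]
        refine hf.congr_fun fun n => ?_
        change A n * (z : ℂ) ^ (n + 1) = z * (A n * (z : ℂ) ^ n)
        ring
      have := hg.sub hf'
      rw [h z, Pi.smul_apply, smul_eq_mul, sub_self] at this
      refine this.congr_fun fun n => ?_
      simp only [B]
      ring
    refine ⟨?_, fun n => ?_⟩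
    · simpa using congrFun key 0
    · exact sub_eq_zero.1 (congrFun key (n + 1))

/-- A unitary equivalence of multiplication operators, in coordinates. -/
lemma UnitarilyEquivalent.exists_coord {m : ℕ} {lam lam' : ℝ} {hlam : (m : ℝ) / 2 < lam}
    {hlam' : (m : ℝ) / 2 < lam'} {mu mu' : Fin (m + 1) → ℝ} {hmu : ∀ j, 0 < mu j}
    {hmu' : ∀ j, 0 < mu' j} (h : UnitarilyEquivalent (mulOp hlam hmu) (mulOp hlam' hmu')) :
    ∃ W : CoordSpace m ≃ₗᵢ[ℂ] CoordSpace m,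
      ∀ a b, ShiftRel lam mu a b ↔ ShiftRel lam' mu' (W a) (W b) := by
  obtain ⟨U, hdom, hU⟩ := h
  -- The value of `mulOp` is a chosen witness; injectivity of `VecSpace.fn` makes it the only one,
  -- so the graph of `mulOp` is the relation g = z f.
  have hmul : ∀ {lam : ℝ} (hlam : (m : ℝ) / 2 < lam) {mu : Fin (m + 1) → ℝ}
      (hmu : ∀ j, 0 < mu j) (f g : VecSpace hlam hmu),
      (∀ z : 𝔻, VecSpace.fn g z = (z : ℂ) • VecSpace.fn f z) ↔
        ∃ hf : f ∈ (mulOp hlam hmu).domain, mulOp hlam hmu ⟨f, hf⟩ = g := by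
    intro lam hlam mu hmu f g
    constructor
    · intro hfg
      have hf : f ∈ (mulOp hlam hmu).domain := ⟨g, hfg⟩
      refine ⟨hf, VecSpace.fn_injective (funext fun z => ?_)⟩
      rw [hfg z]
      exact hf.choose_spec z
    · rintro ⟨hf, rfl⟩ z
      exact hf.choose_spec z
  refine ⟨((coordEquiv hlam hmu).symm.trans U).trans (coordEquiv hlam' hmu'), fun a b => ?_⟩
  obtain ⟨f, rfl⟩ := (coordEquiv hlam hmu).surjective a
  obtain ⟨g, rfl⟩ := (coordEquiv hlam hmu).surjective b
  simp only [LinearIsometryEquiv.trans_apply, LinearIsometryEquiv.symm_apply_apply,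
    shiftRel_coordEquiv_iff, hmul]
  constructor
  · rintro ⟨hf, rfl⟩
    exact ⟨(hdom f).1 hf, (hU ⟨f, hf⟩ ⟨U f, (hdom f).1 hf⟩ rfl).symm⟩
  · rintro ⟨hf, hg⟩
    refine ⟨(hdom f).2 hf, U.injective ?_⟩
    rw [← hg]
    exact hU ⟨f, (hdom f).2 hf⟩ ⟨U f, hf⟩ rfl

/-! ### Matrices intertwining graded families -/

/-- The part of degree `d` of a matrix. -/
def degreePart {N : ℕ} (V : Matrix (Fin N) (Fin N) ℂ) (d : ℤ) : Matrix (Fin N) (Fin N) ℂ :=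
  fun i j => if (i : ℤ) = j + d then V i j else 0

lemma degreePart_mul_comm {N : ℕ} {V G G' : Matrix (Fin N) (Fin N) ℂ} {k : ℤ}
    (hG : ∀ i j : Fin N, (j : ℤ) ≠ i + k → G i j = 0)
    (hG' : ∀ i j : Fin N, (j : ℤ) ≠ i + k → G' i j = 0)
    (h : V * G = G' * V) (d : ℤ) : degreePart V d * G = G' * degreePart V d := by
  ext i l
  have h1 : ∀ j, degreePart V d i j * G j l =
      if (i : ℤ) + k = l + d then V i j * G j l else 0 := by
    intro j
    by_cases hj : (l : ℤ) = j + k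
    · by_cases hi : (i : ℤ) = j + d
      · rw [degreePart, if_pos hi, if_pos (by omega)]
      · rw [degreePart, if_neg hi, if_neg (by omega), zero_mul]
    · simp [hG j l hj]
  have h2 : ∀ j, G' i j * degreePart V d j l =
      if (i : ℤ) + k = l + d then G' i j * V j l else 0 := by
    intro j
    by_cases hj : (j : ℤ) = i + k
    · by_cases hi : (j : ℤ) = l + d
      · rw [degreePart, if_pos hi, if_pos (by omega)]
      · rw [degreePart, if_neg hi, if_neg (by omega), mul_zero]
    · simp [hG' i j hj]
  rw [Matrix.mul_apply, Matrix.mul_apply, Finset.sum_congr rfl fun j _ => h1 j,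
    Finset.sum_congr rfl fun j _ => h2 j]
  split_ifs
  · rw [← Matrix.mul_apply, ← Matrix.mul_apply, h]
  · simp

/-- A unitary matrix that intertwines two graded families of matrices is diagonal if the first
family is connected. -/
theorem diagonal_of_intertwines {N : ℕ} {V : Matrix (Fin N) (Fin N) ℂ}
    (hV : V.conjTranspose * V = 1) (G G' : ℕ → Matrix (Fin N) (Fin N) ℂ)
    (hG : ∀ k, ∀ i j : Fin N, (j : ℕ) ≠ i + k → G k i j = 0)
    (hG' : ∀ k, ∀ i j : Fin N, (j : ℕ) ≠ i + k → G' k i j = 0)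
    (h : ∀ k, V.conjTranspose * G' k * V = G k)
    (hconn : ∀ X : Fin N → ℂ,
      (∀ k, ∀ i j : Fin N, G k i j ≠ 0 → X i = X j) → ∀ i j, X i = X j)
    {i j : Fin N} (hij : i ≠ j) : V i j = 0 := by
  have hV' : V * V.conjTranspose = 1 := mul_eq_one_comm.1 hV
  have h1 : ∀ k, V * G k = G' k * V := fun k => by
    rw [← h k, ← Matrix.mul_assoc, ← Matrix.mul_assoc, hV', Matrix.one_mul]
  have h2 : ∀ k, V * (G k).conjTranspose = (G' k).conjTranspose * V := fun k => by
    rw [← h k]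
    simp only [Matrix.conjTranspose_mul, Matrix.conjTranspose_conjTranspose]
    rw [← Matrix.mul_assoc, hV', Matrix.one_mul]
  -- Each G k and G' k is homogeneous, so the part D of V of degree d intertwines the two families
  -- and their adjoints by itself. Then D* D commutes with every G k. It remains to see that D = 0
  -- in column j.
  set d : ℤ := (i : ℤ) - j with hd
  have hd0 : d ≠ 0 := fun h0 => hij (Fin.ext (by omega))
  set D := degreePart V d with hD
  have e1 : ∀ k, D * G k = G' k * D := fun k =>
    degreePart_mul_comm (k := k) (fun i j hh => hG k i j (by omega))
      (fun i j hh => hG' k i j (by omega)) (h1 k) d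
  have e2 : ∀ k, D * (G k).conjTranspose = (G' k).conjTranspose * D := fun k =>
    degreePart_mul_comm (k := -k)
      (fun i j hh => by rw [Matrix.conjTranspose_apply, hG k j i (by omega), star_zero])
      (fun i j hh => by rw [Matrix.conjTranspose_apply, hG' k j i (by omega), star_zero]) (h2 k) d
  have e3 : ∀ k, G k * D.conjTranspose = D.conjTranspose * G' k := fun k => by
    have := congrArg Matrix.conjTranspose (e2 k)
    simpa only [Matrix.conjTranspose_mul, Matrix.conjTranspose_conjTranspose] using this
  have e4 : ∀ k, D.conjTranspose * D * G k = G k * (D.conjTranspose * D) := fun k => by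
    rw [Matrix.mul_assoc, e1, ← Matrix.mul_assoc, ← e3, Matrix.mul_assoc]
  -- Column p of D has at most one nonzero entry, in row p + d, so distinct columns are orthogonal.
  have hX : ∀ p q, p ≠ q → (D.conjTranspose * D) p q = 0 := by
    intro p q hpq
    rw [Matrix.mul_apply]
    refine Finset.sum_eq_zero fun r _ => ?_
    rw [Matrix.conjTranspose_apply, hD, degreePart, degreePart]
    by_cases hp : (r : ℤ) = p + d
    · rw [if_neg (c := (r : ℤ) = q + d) (fun hq => hpq (Fin.ext (by omega))), mul_zero]
    · rw [if_neg hp, star_zero, zero_mul]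
  have hc := hconn (fun p => (D.conjTranspose * D) p p) (by
    intro k p q hpq
    have h5 := congrFun (congrFun (e4 k) p) q
    rw [Matrix.mul_apply, Matrix.mul_apply, Finset.sum_eq_single p, Finset.sum_eq_single q] at h5
    · exact mul_right_cancel₀ hpq (by rw [h5, mul_comm])
    · intro r _ hr
      rw [hX r q hr, mul_zero]
    · simp
    · intro r _ hr
      rw [hX p r hr.symm, zero_mul]
    · simp)
  have hpos : 0 < N := i.pos
  -- As d ≠ 0, the row p + d falls outside the matrix for p = 0 or for p = N - 1, and that column of
  -- D is empty. The diagonal of D* D is constant, so every column vanishes.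
  have hz : ∃ p : Fin N, (D.conjTranspose * D) p p = 0 := by
    have aux : ∀ p : Fin N, (∀ r : Fin N, (r : ℤ) ≠ p + d) → (D.conjTranspose * D) p p = 0 := by
      intro p hp
      rw [Matrix.mul_apply]
      refine Finset.sum_eq_zero fun r _ => ?_
      rw [hD, degreePart, if_neg (hp r), mul_zero]
    rcases lt_or_gt_of_ne hd0 with hneg | hgt
    · exact ⟨⟨0, hpos⟩, aux _ fun r => by simp only; omega⟩
    · exact ⟨⟨N - 1, by omega⟩, aux _ fun r => by have := r.2; simp only; omega⟩
  obtain ⟨p, hp⟩ := hz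
  have hj := hc j p
  simp only [hp, Matrix.mul_apply, Matrix.conjTranspose_apply] at hj
  have hj' : ∑ r, ‖D r j‖ ^ 2 = 0 := by
    have h6 : ∀ r, star (D r j) * D r j = ((‖D r j‖ ^ 2 : ℝ) : ℂ) := fun r => by
      rw [Complex.star_def, Complex.conj_mul']
      push_cast
      rfl
    rw [Finset.sum_congr rfl fun r _ => h6 r] at hj
    exact_mod_cast hj
  have h7 := (Finset.sum_eq_zero_iff_of_nonneg fun r _ => by positivity).1 hj' i (Finset.mem_univ _)
  have h8 : D i j = V i j := by rw [hD, degreePart, if_pos (by omega)]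
  rw [← h8]
  simpa using h7

/-! ### Finite differences and connectedness -/

/-- The alternating binomial sum `∑ (-1)^q (k choose q) c (p + q)`. -/
def altDiff (c : ℕ → ℝ) (k p : ℕ) : ℝ :=
  ∑ q ∈ Finset.range (k + 1), (-1) ^ q * (k.choose q : ℝ) * c (p + q)

lemma altDiff_succ (c : ℕ → ℝ) (k p : ℕ) :
    altDiff c (k + 1) p = altDiff (fun r => c r - c (r + 1)) k p := by
  have h1 : altDiff c (k + 1) p = c p + ∑ q ∈ Finset.range (k + 1),
      (-1) ^ (q + 1) * ((k.choose q : ℝ) + k.choose (q + 1)) * c (p + (q + 1)) := by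
    rw [altDiff, Finset.sum_range_succ']
    simp [Nat.choose_succ_succ, add_comm]
  have h2 : altDiff c k p = c p + ∑ q ∈ Finset.range (k + 1),
      (-1) ^ (q + 1) * (k.choose (q + 1) : ℝ) * c (p + (q + 1)) := by
    rw [Finset.sum_range_succ, Nat.choose_succ_self, altDiff, Finset.sum_range_succ']
    simp [add_comm]
  have h3 : altDiff (fun r => c r - c (r + 1)) k p = altDiff c k p -
      ∑ q ∈ Finset.range (k + 1), (-1) ^ q * (k.choose q : ℝ) * c (p + q + 1) := by
    simp only [altDiff, mul_sub, Finset.sum_sub_distrib]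
  rw [h1, h3, h2, add_sub_assoc, ← Finset.sum_sub_distrib]
  congr 1
  refine Finset.sum_congr rfl fun q _ => ?_
  rw [pow_succ, add_assoc]
  ring

lemma altDiff_const (a : ℝ) {k : ℕ} (hk : k ≠ 0) (p : ℕ) : altDiff (fun _ => a) k p = 0 := by
  obtain ⟨k, rfl⟩ := Nat.exists_eq_succ_of_ne_zero hk
  rw [altDiff_succ]
  simp [altDiff]

lemma altDiff_sub (c c' : ℕ → ℝ) (k p : ℕ) :
    altDiff (fun r => c r - c' r) k p = altDiff c k p - altDiff c' k p := by
  simp only [altDiff, mul_sub, Finset.sum_sub_distrib]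

/-- Subtracting the constant c p does not change the difference when k > 0, and leaves only the last
term, ±(c (p + k) - c p). -/
lemma altDiff_ne_zero_right {c : ℕ → ℝ} {k p : ℕ} (hk : k ≠ 0)
    (h : ∀ q < k, c (p + q) = c p) (hne : c (p + k) ≠ c p) : altDiff c k p ≠ 0 := by
  have h1 : altDiff c k p = altDiff (fun r => c r - c p) k p := by
    rw [altDiff_sub, altDiff_const _ hk, sub_zero]
  rw [h1, altDiff, Finset.sum_range_succ, Finset.sum_eq_zero]
  · simp [sub_eq_zero, hne]
  · intro q hq
    simp [h q (Finset.mem_range.1 hq)]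

lemma altDiff_ne_zero_left {c : ℕ → ℝ} {k p : ℕ} (hk : k ≠ 0)
    (h : ∀ q < k, c (p + (q + 1)) = c (p + k)) (hne : c p ≠ c (p + k)) : altDiff c k p ≠ 0 := by
  have h1 : altDiff c k p = altDiff (fun r => c r - c (p + k)) k p := by
    rw [altDiff_sub, altDiff_const _ hk, sub_zero]
  rw [h1, altDiff, Finset.sum_range_succ', Finset.sum_eq_zero]
  · simp [sub_eq_zero, hne]
  · intro q hq
    simp [h q (Finset.mem_range.1 hq)]

/-- A function that agrees at the two ends of every nonvanishing difference of a nonconstant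
sequence is constant. -/
lemma eq_of_altDiff_ne_zero {α : Type*} {m : ℕ} {c : ℕ → ℝ} (hc : c 0 ≠ c m) {X : ℕ → α}
    (hX : ∀ k p, p + k ≤ m → altDiff c k p ≠ 0 → X p = X (p + k)) {l : ℕ} (hl : l ≤ m) :
    X l = X 0 := by
  -- An index is linked to the first later index with a different value of c; `down` links an index
  -- to the last earlier one with a different value.
  have up : ∀ p i, p < i → i ≤ m → (∀ r, p ≤ r → r < i → c r = c p) → c i ≠ c p → X p = X i := by
    intro p i hpi him hr hne
    obtain ⟨k, rfl⟩ := Nat.exists_eq_add_of_le hpi.le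
    exact hX k p him (altDiff_ne_zero_right (by omega)
      (fun q hq => hr _ (by omega) (by omega)) hne)
  have down : ∀ p i, p < i → i ≤ m → (∀ r, p < r → r ≤ i → c r = c i) → c p ≠ c i →
      X p = X i := by
    intro p i hpi him hr hne
    obtain ⟨k, rfl⟩ := Nat.exists_eq_add_of_le hpi.le
    exact hX k p him (altDiff_ne_zero_left (by omega)
      (fun q hq => hr _ (by omega) (by omega)) hne)
  induction l with
  | zero => rfl
  | succ l ih =>
    rw [← ih (by omega)]
    by_cases h1 : c (l + 1) = c l
    -- When c l = c (l + 1), the two indices are linked through a common third one: the first later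
    -- index with another value, or, if c is constant from l to m, the last earlier such index,
    -- which exists because c 0 ≠ c m.
    · by_cases h2 : ∃ i, l < i ∧ i ≤ m ∧ c i ≠ c l
      · classical
        obtain ⟨hi1, hi2, hi3⟩ := Nat.find_spec h2
        have hmin : ∀ r, l ≤ r → r < Nat.find h2 → c r = c l := by
          intro r hr1 hr2
          have := Nat.find_min h2 hr2
          rcases hr1.eq_or_lt with rfl | hlt
          · rfl
          · by_contra hne
            exact this ⟨hlt, by omega, hne⟩
        have hlt : l + 1 < Nat.find h2 := by
          rcases (Nat.succ_le_of_lt hi1).eq_or_lt with he | hlt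
          · rw [← he] at hi3
            exact absurd h1 hi3
          · exact hlt
        rw [up l _ hi1 hi2 hmin hi3]
        exact up (l + 1) _ hlt hi2 (fun r hr1 hr2 => by rw [hmin r (by omega) hr2, h1])
          (by rwa [h1])
      · push Not at h2
        have h3 : ∃ i, i ≤ l ∧ c (l - i) ≠ c l := by
          refine ⟨l, le_rfl, ?_⟩
          rw [Nat.sub_self, ← h2 m (by omega) le_rfl]
          exact hc
        classical
        obtain ⟨hi1, hi2⟩ := Nat.find_spec h3
        have hpos : Nat.find h3 ≠ 0 := by
          intro h0
          rw [h0] at hi2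
          exact hi2 rfl
        have hmin : ∀ r, l - Nat.find h3 < r → r ≤ l → c r = c l := by
          intro r hr1 hr2
          by_contra hne
          refine Nat.find_min h3 (m := l - r) (by omega) ⟨by omega, ?_⟩
          rwa [Nat.sub_sub_self hr2]
        rw [← down (l - Nat.find h3) l (by omega) (by omega) hmin hi2]
        refine (down (l - Nat.find h3) (l + 1) (by omega) hl (fun r hr1 hr2 => ?_)
          (by rwa [h1])).symm
        rcases hr2.eq_or_lt with rfl | hlt
        · rfl
        · rw [h1]
          exact hmin r hr1 (by omega)
    · exact (up l (l + 1) (by omega) hl (fun r _ _ => by rw [show r = l by omega]) h1).symm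

/-! ### The Gram matrix of the Taylor functionals -/

section Gram

variable {m : ℕ} {lam : ℝ} {mu : Fin (m + 1) → ℝ}

/-- The squared norm of the functional `f ↦ f_r(0)`. -/
def normSeq (lam : ℝ) (mu : Fin (m + 1) → ℝ) (r : ℕ) : ℝ :=
  ∑ j : Fin (m + 1), mu j ^ 2 *
    ((r.choose j : ℝ) ^ 2 * (r - j).factorial / poch (2 * lamIdx lam j) (r - j))

lemma two_mul_lamIdx_pos (hlam : (m : ℝ) / 2 < lam) (j : Fin (m + 1)) : 0 < 2 * lamIdx lam j := by
  linarith [lamIdx_pos hlam j]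

lemma normSeq_pos (hlam : (m : ℝ) / 2 < lam) (hmu : ∀ j, 0 < mu j) (r : ℕ) :
    0 < normSeq lam mu r := by
  have hp := fun j : Fin (m + 1) => poch_pos (two_mul_lamIdx_pos hlam j) (r - j)
  refine Finset.sum_pos' (fun j _ => ?_) ⟨0, Finset.mem_univ _, ?_⟩
  · have := hp j
    positivity
  · have := hp 0
    have := hmu 0
    simp only [Fin.val_zero, Nat.choose_zero_right] at *
    positivity

lemma poch_succ (x : ℝ) (n : ℕ) : poch x (n + 1) = poch x n * (x + n) := by
  simp [poch, ascPochhammer_succ_right]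

lemma basisCoeff_sq {s : ℝ} (hs : 0 < s) (n : ℕ) :
    basisCoeff s n * basisCoeff s n = poch (2 * s) n / n.factorial :=
  Real.mul_self_sqrt (div_nonneg (poch_pos (by linarith) n).le (by positivity))

/-- Give the basis vector with index (j, i) the degree i + j. Then `taylorVec lam mu n l` is
homogeneous of degree n + l, and different degrees are orthogonal. -/
lemma inner_taylorVec_taylorVec (n l n' l' : ℕ) :
    inner ℂ (taylorVec lam mu n l) (taylorVec lam mu n' l') =
      if n + l = n' + l' then
        ((∑ j, taylorCoef lam mu n l j * taylorCoef lam mu n' l' j : ℝ) : ℂ) else 0 := by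
  rw [inner_taylorVec]
  split_ifs with h
  · push_cast
    refine Finset.sum_congr rfl fun j _ => ?_
    simp [taylorVec, h]
  · refine Finset.sum_eq_zero fun j _ => ?_
    rcases lt_or_ge l j with hl | hl
    · simp [taylorCoef_of_lt _ _ _ hl]
    rcases lt_or_ge l' j with hl' | hl'
    · simp [taylorVec, taylorCoef_of_lt _ _ _ hl']
    have : n + l - j ≠ n' + l' - j := by omega
    simp [taylorVec, lp.single_apply, this]

lemma inner_taylorVec_of_ne {n l n' l' : ℕ} (h : n + l ≠ n' + l') :
    inner ℂ (taylorVec lam mu n l) (taylorVec lam mu n' l') = 0 := by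
  rw [inner_taylorVec_taylorVec, if_neg h]

lemma inner_taylorVec_zero (hlam : (m : ℝ) / 2 < lam) {n p l : ℕ} (h : n + p = l) :
    inner ℂ (taylorVec lam mu n p) (taylorVec lam mu 0 l) =
      ((l.choose p * normSeq lam mu p : ℝ) : ℂ) := by
  subst h
  rw [inner_taylorVec_taylorVec, if_pos (by omega), normSeq, Finset.mul_sum]
  congr 1
  refine Finset.sum_congr rfl fun j _ => ?_
  rcases lt_or_ge p j with hp | hp
  · simp [taylorCoef_of_lt _ _ _ hp, Nat.choose_eq_zero_of_lt hp]
  obtain ⟨s, rfl⟩ := Nat.exists_eq_add_of_le hp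
  have hb := basisCoeff_sq (lamIdx_pos hlam j) (n + s)
  have h1 := poch_pos (two_mul_lamIdx_pos hlam j) s
  have h2 := poch_pos (two_mul_lamIdx_pos hlam j) (n + s)
  have e0 : (j : ℕ) + s - j = s := by omega
  have e1 : n + ((j : ℕ) + s) - j = n + s := by omega
  have c1 := Nat.cast_add_choose ℝ (a := (j : ℕ)) (b := s)
  have c2 := Nat.cast_add_choose ℝ (a := (j : ℕ)) (b := n + s)
  have c3 := Nat.cast_add_choose ℝ (a := (j : ℕ) + s) (b := n)
  rw [show (j : ℕ) + (n + s) = n + (j + s) by ring] at c2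
  rw [show (j : ℕ) + s + n = n + (j + s) by ring] at c3
  simp only [taylorCoef, e0, e1, zero_add]
  rw [c1, c2, c3]
  have hfn : ((n + s).factorial : ℝ) ≠ 0 := by positivity
  calc _ = mu j ^ 2 * ((((j : ℕ) + s).factorial : ℝ) / ((j : ℕ).factorial * s.factorial) /
            poch (2 * lamIdx lam j) s) *
          (((n + ((j : ℕ) + s)).factorial : ℝ) / ((j : ℕ).factorial * (n + s).factorial) /
            poch (2 * lamIdx lam j) (n + s)) * ((n + s).factorial / n.factorial) *
          ((n + s).factorial / (0).factorial) *
          (basisCoeff (lamIdx lam j) (n + s) * basisCoeff (lamIdx lam j) (n + s)) := by ring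
    _ = _ := by
      rw [hb]
      simp only [Nat.factorial_zero, Nat.cast_one]
      field_simp

/-- The summand for j of `inner_taylorVec_one`. The point is that 2 λ_j - 2 j = 2 λ - m does not
depend on j, so after summation over j only `normSeq` at r and r - 1 remains. -/
lemma taylorCoef_one_mul (hlam : (m : ℝ) / 2 < lam) {n r l : ℕ} (h : n + r = l + 1)
    (j : Fin (m + 1)) :
    taylorCoef lam mu 1 l j * taylorCoef lam mu n r j =
      (2 * lam - m + r + l) * l.choose r * (mu j ^ 2 *
        ((r.choose j : ℝ) ^ 2 * (r - j).factorial / poch (2 * lamIdx lam j) (r - j))) +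
      r * l.choose (r - 1) * (mu j ^ 2 * (((r - 1).choose j : ℝ) ^ 2 *
        (r - 1 - j).factorial / poch (2 * lamIdx lam j) (r - 1 - j))) := by
  have hnu : 2 * lam - m = 2 * lamIdx lam j - 2 * (j : ℕ) := by rw [lamIdx]; ring
  rw [hnu]
  rcases lt_trichotomy r (j : ℕ) with hr | hr | hr
  · simp [taylorCoef_of_lt _ _ _ hr, Nat.choose_eq_zero_of_lt hr,
      Nat.choose_eq_zero_of_lt (show r - 1 < j by omega)]
  · have h0 : (r : ℝ) * l.choose (r - 1) * (mu j ^ 2 * (((r - 1).choose j : ℝ) ^ 2 *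
        (r - 1 - j).factorial / poch (2 * lamIdx lam j) (r - 1 - j))) = 0 := by
      rcases Nat.eq_zero_or_pos r with rfl | hpos
      · simp
      · simp [Nat.choose_eq_zero_of_lt (show r - 1 < j by omega)]
    rw [h0, add_zero, ← hr]
    rcases Nat.eq_zero_or_pos n with rfl | hn
    · have hl : l < j := by omega
      rw [taylorCoef_of_lt _ _ _ hl, Nat.choose_eq_zero_of_lt (show l < r by omega)]
      simp
    obtain ⟨n, rfl⟩ : ∃ k, n = k + 1 := ⟨n - 1, by omega⟩
    obtain rfl : l = n + r := by omega
    have hb := basisCoeff_sq (lamIdx_pos hlam j) (n + 1)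
    have h1 := poch_pos (two_mul_lamIdx_pos hlam j) n
    rw [poch_succ] at hb
    have e1 : 1 + (n + r) - r = n + 1 := by omega
    have e2 : n + 1 + r - r = n + 1 := by omega
    have e3 : n + r - r = n := by omega
    simp only [taylorCoef, ← hr, e1, e2, e3, Nat.sub_self, Nat.choose_self]
    have hp0 : poch (2 * lamIdx lam j) 0 = 1 := by simp [poch]
    rw [hp0]
    calc _ = mu j ^ 2 * (((n + r).choose r : ℝ) / poch (2 * lamIdx lam j) n) *
          (n + 1).factorial *
          (basisCoeff (lamIdx lam j) (n + 1) * basisCoeff (lamIdx lam j) (n + 1)) := by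
            simp only [Nat.factorial_one, Nat.cast_one]
            field_simp
      _ = _ := by
        rw [hb]
        push_cast
        simp only [Nat.factorial_zero, Nat.cast_one]
        field_simp
        ring
  · obtain ⟨s, rfl⟩ : ∃ s, r = j + s + 1 := ⟨r - j - 1, by omega⟩
    obtain rfl : l = n + (j + s) := by omega
    have hb := basisCoeff_sq (lamIdx_pos hlam j) (n + s + 1)
    have h1 := poch_pos (two_mul_lamIdx_pos hlam j) s
    have h2 := poch_pos (two_mul_lamIdx_pos hlam j) (n + s)
    have h3 := two_mul_lamIdx_pos hlam j
    have h4 : 0 < 2 * lamIdx lam j + s := by positivity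
    have h5 : 0 < 2 * lamIdx lam j + (n + s : ℕ) := by positivity
    have e0 : (j : ℕ) + s + 1 - j = s + 1 := by omega
    have e1 : 1 + (n + ((j : ℕ) + s)) - j = n + s + 1 := by omega
    have e2 : n + ((j : ℕ) + s) - j = n + s := by omega
    have e3 : n + ((j : ℕ) + s + 1) - j = n + s + 1 := by omega
    have e4 : (j : ℕ) + s - j = s := by omega
    have c1 := Nat.cast_add_choose ℝ (a := (j : ℕ)) (b := s)
    have c2 := Nat.cast_add_choose ℝ (a := (j : ℕ)) (b := n + s)
    have c3 := Nat.cast_add_choose ℝ (a := (j : ℕ) + s) (b := n)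
    have c4 := Nat.cast_add_choose ℝ (a := (j : ℕ)) (b := s + 1)
    have c5 : ((n + ((j : ℕ) + s)).choose (j + s + 1) : ℝ) =
        (n + ((j : ℕ) + s)).choose (j + s) * n / ((j : ℕ) + s + 1) := by
      rw [eq_div_iff (by positivity)]
      have := Nat.choose_succ_right_eq (n + ((j : ℕ) + s)) (j + s)
      rw [Nat.add_sub_cancel] at this
      exact_mod_cast this
    rw [show (j : ℕ) + (n + s) = n + (j + s) by ring] at c2
    rw [show (j : ℕ) + s + n = n + (j + s) by ring] at c3
    rw [show (j : ℕ) + (s + 1) = j + s + 1 by ring] at c4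
    simp only [taylorCoef, e0, e1, e2, e3, e4, Nat.add_sub_cancel]
    rw [c5, c1, c2, c3, c4]
    rw [poch_succ] at hb
    rw [poch_succ]
    calc _ = mu j ^ 2 * (((n + ((j : ℕ) + s)).factorial : ℝ) /
            ((j : ℕ).factorial * (n + s).factorial) / poch (2 * lamIdx lam j) (n + s)) *
          ((((j : ℕ) + s + 1).factorial : ℝ) / ((j : ℕ).factorial * (s + 1).factorial) /
            (poch (2 * lamIdx lam j) s * (2 * lamIdx lam j + s))) *
          ((n + s + 1).factorial / (1).factorial) * ((n + s + 1).factorial / n.factorial) *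
          (basisCoeff (lamIdx lam j) (n + s + 1) * basisCoeff (lamIdx lam j) (n + s + 1)) := by
            ring
      _ = _ := by
        rw [hb]
        simp only [Nat.cast_one, Nat.factorial_succ, Nat.cast_mul, Nat.cast_add]
        field_simp
        ring

lemma inner_taylorVec_one (hlam : (m : ℝ) / 2 < lam) {n r l : ℕ} (h : n + r = l + 1) :
    inner ℂ (taylorVec lam mu 1 l) (taylorVec lam mu n r) =
      (((2 * lam - m + r + l) * l.choose r * normSeq lam mu r +
        r * l.choose (r - 1) * normSeq lam mu (r - 1) : ℝ) : ℂ) := by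
  rw [inner_taylorVec_taylorVec, if_pos (by omega), normSeq, normSeq, Finset.mul_sum,
    Finset.mul_sum, ← Finset.sum_add_distrib]
  congr 1
  exact Finset.sum_congr rfl fun j _ => taylorCoef_one_mul hlam h j

end Gram

section Wandering

variable {m : ℕ} {lam : ℝ} {mu : Fin (m + 1) → ℝ}

/-! ### The monomials -/

lemma taylorCoef_self_ne_zero (hlam : (m : ℝ) / 2 < lam) (hmu : ∀ j, 0 < mu j) (n : ℕ)
    (j : Fin (m + 1)) : taylorCoef lam mu n j j ≠ 0 := by
  have h1 := hmu j
  have h2 := poch_pos (two_mul_lamIdx_pos hlam j) (j - j)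
  have h3 := basisCoeff_pos (lamIdx_pos hlam j) (n + j - j)
  rw [taylorCoef, Nat.choose_self]
  positivity

lemma eq_zero_of_inner_taylorVec (hlam : (m : ℝ) / 2 < lam) (hmu : ∀ j, 0 < mu j)
    {a : CoordSpace m} (h : ∀ n, ∀ l ≤ m, inner ℂ (taylorVec lam mu n l) a = 0) : a = 0 := by
  have key : ∀ l : ℕ, ∀ j : Fin (m + 1), (j : ℕ) = l → ∀ n, a j n = 0 := by
    intro l
    induction l using Nat.strong_induction_on with
    | _ l ih =>
      rintro j rfl n
      have h1 := h n j (Nat.lt_succ_iff.1 j.2)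
      rw [inner_taylorVec, Finset.sum_eq_single j] at h1
      · have h2 : (taylorCoef lam mu n j j : ℂ) ≠ 0 := by
          exact_mod_cast taylorCoef_self_ne_zero hlam hmu n j
        simpa [h2] using h1
      · intro i _ hi
        rcases lt_or_gt_of_ne hi with hlt | hgt
        · rw [ih i hlt i rfl, mul_zero]
        · rw [taylorCoef_of_lt _ _ _ hgt, ofReal_zero, zero_mul]
      · simp
  ext j n
  exact key j j rfl n

/-- The basis vector with index `(j, n)`. -/
def basisVec (j : Fin (m + 1)) (n : ℕ) : CoordSpace m :=
  WithLp.toLp 2 (Pi.single j (lp.single 2 n (1 : ℂ)))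

lemma inner_taylorVec_basisVec (n l : ℕ) (j : Fin (m + 1)) (n' : ℕ) :
    inner ℂ (taylorVec lam mu n l) (basisVec j n') =
      if n + l = n' + j then (taylorCoef lam mu n l j : ℂ) else 0 := by
  rw [inner_taylorVec, Finset.sum_eq_single j]
  · rcases lt_or_ge l j with hl | hl
    · simp [taylorCoef_of_lt _ _ _ hl]
    · have : n + l - j = n' ↔ n + l = n' + j := by omega
      simp [basisVec, lp.single_apply, Pi.single_apply, this]
  · intro i _ hi
    simp [basisVec, hi]
  · simp

lemma inner_basisVec (a : CoordSpace m) (j : Fin (m + 1)) (n : ℕ) :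
    inner ℂ (basisVec j n) a = a j n := by
  rw [PiLp.inner_apply, Finset.sum_eq_single j]
  · simp only [basisVec, Pi.single_eq_same]
    rw [lp.inner_single_left]
    simp
  · intro i _ hi
    simp [basisVec, hi]
  · simp

/-- The monomial `z ^ n' ε_{l'}` belongs to the space. -/
lemma exists_monomial (hlam : (m : ℝ) / 2 < lam) (hmu : ∀ j, 0 < mu j) :
    ∃ P : ℕ → ℕ → CoordSpace m, ∀ n', ∀ l' ≤ m, ∀ n, ∀ l ≤ m,
      inner ℂ (taylorVec lam mu n l) (P n' l') = if n = n' ∧ l = l' then 1 else 0 := by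
  have key : ∀ i : ℕ, ∀ l' n' : ℕ, ∃ v : CoordSpace m, l' + i = m → ∀ n, ∀ l ≤ m,
      inner ℂ (taylorVec lam mu n l) v = if n = n' ∧ l = l' then 1 else 0 := by
    intro i
    -- Descending induction on l' = m - i: the basis vector (l', n') has components only in
    -- positions l ≥ l', each a multiple of one monomial. Subtracting those with l > l' and dividing
    -- by the leading coefficient leaves z ^ n' in position l'.
    induction i using Nat.strong_induction_on with
    | _ i ih =>
      intro l' n'
      by_cases hl' : l' + i = m
      swap
      · exact ⟨0, fun h => absurd h hl'⟩
      set j : Fin (m + 1) := ⟨l', by omega⟩ with hj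
      have ih' : ∀ p n' : ℕ, ∃ v : CoordSpace m, l' < p → p ≤ m → ∀ n, ∀ l ≤ m,
          inner ℂ (taylorVec lam mu n l) v = if n = n' ∧ l = p then 1 else 0 := by
        intro p n'
        by_cases hp : l' < p ∧ p ≤ m
        · obtain ⟨v, hv⟩ := ih (m - p) (by omega) p n'
          exact ⟨v, fun _ _ => hv (by omega)⟩
        · exact ⟨0, fun h1 h2 => absurd ⟨h1, h2⟩ hp⟩
      choose Q hQ using ih'
      have hc : (taylorCoef lam mu n' l' j : ℂ) ≠ 0 := by
        exact_mod_cast taylorCoef_self_ne_zero hlam hmu n' j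
      refine ⟨(taylorCoef lam mu n' l' j : ℂ)⁻¹ • (basisVec j n' - ∑ p ∈ Finset.Ioc l' m,
        if p ≤ n' + l' then (taylorCoef lam mu (n' + l' - p) p j : ℂ) • Q p (n' + l' - p) else 0),
        fun _ n l hl => ?_⟩
      rw [inner_smul_right, inner_sub_right, inner_sum, inner_taylorVec_basisVec]
      have hterm : ∀ p ∈ Finset.Ioc l' m, inner ℂ (taylorVec lam mu n l)
          (if p ≤ n' + l' then (taylorCoef lam mu (n' + l' - p) p j : ℂ) • Q p (n' + l' - p) else 0)
          = if p = l then (if n + l = n' + l' then (taylorCoef lam mu n l j : ℂ) else 0) else 0 := by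
        intro p hp
        rw [Finset.mem_Ioc] at hp
        by_cases hpl : p = l
        · subst hpl
          rw [if_pos rfl]
          by_cases hn : n + p = n' + l'
          · have e : n' + l' - p = n := by omega
            rw [if_pos (by omega), if_pos hn, inner_smul_right, hQ _ _ hp.1 hp.2 _ _ hl, e]
            simp
          · rw [if_neg hn]
            split_ifs with h
            · rw [inner_smul_right, hQ _ _ hp.1 hp.2 _ _ hl, if_neg (by omega), mul_zero]
            · exact inner_zero_right _
        · rw [if_neg hpl]
          split_ifs with h
          · rw [inner_smul_right, hQ _ _ hp.1 hp.2 _ _ hl, if_neg (by omega), mul_zero]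
          · exact inner_zero_right _
      rw [Finset.sum_congr rfl hterm, Finset.sum_ite_eq']
      change _ * ((if n + l = n' + l' then _ else _) - _) = _
      rcases lt_trichotomy l l' with hlt | heq | hgt
      · rw [taylorCoef_of_lt _ _ _ (show l < (j : ℕ) from hlt),
          if_neg (c := n = n' ∧ l = l') (by omega)]
        simp
      · subst heq
        rw [if_neg (c := l ∈ Finset.Ioc l m) (by simp)]
        by_cases hn : n = n'
        · subst hn
          simp [hc]
        · simp [hn]
      · rw [if_pos (c := l ∈ Finset.Ioc l' m) (Finset.mem_Ioc.2 ⟨hgt, hl⟩),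
          if_neg (c := n = n' ∧ l = l') (by omega), sub_self, mul_zero]
  choose Q hQ using key
  exact ⟨fun n' l' => Q (m - l') l' n', fun n' l' hl' => hQ _ _ _ (by omega)⟩

/-! ### Wandering vectors -/

/-- `y` is orthogonal to the range of multiplication by `z`. -/
def IsWandering (lam : ℝ) (mu : Fin (m + 1) → ℝ) (y : CoordSpace m) : Prop :=
  ∀ a b, ShiftRel lam mu a b → inner ℂ y b = 0

lemma isWandering_taylorVec {l : ℕ} (hl : l ≤ m) : IsWandering lam mu (taylorVec lam mu 0 l) :=
  fun _ _ h => (h l hl).1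

/-- Homogeneous vectors are finite sums of monomials (`hexp`), so it suffices that y is orthogonal
to all monomials. Those divisible by z lie in the range of multiplication; the constants are reached
through the vectors `taylorVec lam mu 0 l`. -/
lemma IsWandering.eq_zero (hlam : (m : ℝ) / 2 < lam) (hmu : ∀ j, 0 < mu j) {y : CoordSpace m}
    (hy : IsWandering lam mu y) (h0 : ∀ l ≤ m, inner ℂ y (taylorVec lam mu 0 l) = 0) : y = 0 := by
  obtain ⟨P, hP⟩ := exists_monomial hlam hmu
  have hexp : ∀ (k : ℕ) (a : CoordSpace m),
      (∀ n, ∀ l ≤ m, n + l ≠ k → inner ℂ (taylorVec lam mu n l) a = 0) →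
      a = ∑ p ∈ Finset.range (m + 1), if p ≤ k then
        inner ℂ (taylorVec lam mu (k - p) p) a • P (k - p) p else 0 := by
    intro k a ha
    rw [← sub_eq_zero]
    refine eq_zero_of_inner_taylorVec hlam hmu fun n l hl => ?_
    rw [inner_sub_right, inner_sum, sub_eq_zero, Finset.sum_eq_single l]
    · by_cases hk : n + l = k
      · have e : k - l = n := by omega
        rw [if_pos (by omega), inner_smul_right, hP _ _ hl _ _ hl, e]
        simp
      · rw [ha n l hl hk]
        split_ifs with h
        · rw [inner_smul_right, hP _ _ hl _ _ hl, if_neg (by omega), mul_zero]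
        · exact (inner_zero_right _).symm
    · intro p hp hpl
      rw [Finset.mem_range] at hp
      split_ifs with h
      · rw [inner_smul_right, hP _ _ (by omega) _ _ hl, if_neg (by tauto), mul_zero]
      · exact inner_zero_right _
    · intro h
      exact absurd (Finset.mem_range.2 (by omega)) h
  have hsucc : ∀ n, ∀ l ≤ m, inner ℂ y (P (n + 1) l) = 0 := by
    intro n l hl
    refine hy (P n l) _ fun p hp => ⟨?_, fun i => ?_⟩
    · rw [hP _ _ hl _ _ hp, if_neg (by omega)]
    · rw [hP _ _ hl _ _ hp, hP _ _ hl _ _ hp]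
      simp
  -- The monomial expansion of `taylorVec lam mu 0 l` contains the constant one in position l with
  -- coefficient b_l ≠ 0; its other terms are divisible by z.
  have hzero : ∀ l ≤ m, inner ℂ y (P 0 l) = 0 := by
    intro l hl
    have h1 := h0 l hl
    rw [hexp l (taylorVec lam mu 0 l) (fun n p _ hne => inner_taylorVec_of_ne (by omega)),
      inner_sum, Finset.sum_eq_single l] at h1
    · rw [if_pos le_rfl, Nat.sub_self, inner_smul_right, inner_taylorVec_zero hlam (by omega),
        Nat.choose_self] at h1
      have hb : ((((1 : ℕ) : ℝ) * normSeq lam mu l : ℝ) : ℂ) ≠ 0 := by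
        have := normSeq_pos hlam hmu l
        exact_mod_cast (by positivity)
      exact (mul_eq_zero.1 h1).resolve_left hb
    · intro p hp hpl
      rw [Finset.mem_range] at hp
      split_ifs with h
      · obtain ⟨n, hn⟩ : ∃ n, l - p = n + 1 := ⟨l - p - 1, by omega⟩
        rw [inner_smul_right, hn, hsucc _ _ (by omega), mul_zero]
      · exact inner_zero_right _
    · intro h
      exact absurd (Finset.mem_range.2 (by omega)) h
  have hall : ∀ n, ∀ l ≤ m, inner ℂ y (P n l) = 0 := by
    rintro (_ | n) l hl
    exacts [hzero l hl, hsucc n l hl]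
  ext j n
  rw [← inner_basisVec, ← inner_conj_symm, hexp (n + j) (basisVec j n)
    (fun i l _ hne => by rw [inner_taylorVec_basisVec, if_neg hne]), inner_sum,
    Finset.sum_eq_zero, map_zero]
  · rfl
  · intro p hp
    rw [Finset.mem_range] at hp
    split_ifs with h
    · rw [inner_smul_right, hall _ _ (by omega), mul_zero]
    · exact inner_zero_right _

/-- The orthonormal basis of the wandering subspace. -/
def wanderVec (lam : ℝ) (mu : Fin (m + 1) → ℝ) (l : ℕ) : CoordSpace m :=
  (((√(normSeq lam mu l))⁻¹ : ℝ) : ℂ) • taylorVec lam mu 0 l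

lemma inner_wanderVec (hlam : (m : ℝ) / 2 < lam) (hmu : ∀ j, 0 < mu j) (l l' : ℕ) :
    inner ℂ (wanderVec lam mu l) (wanderVec lam mu l') = if l = l' then 1 else 0 := by
  rw [wanderVec, wanderVec, inner_smul_left, inner_smul_right, conj_ofReal]
  split_ifs with h
  · subst h
    have hb := normSeq_pos hlam hmu l
    rw [inner_taylorVec_zero hlam (by omega), Nat.choose_self, ← ofReal_mul, ← ofReal_mul,
      ← ofReal_one]
    congr 1
    rw [Nat.cast_one, one_mul, ← mul_assoc, ← mul_inv, Real.mul_self_sqrt hb.le,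
      inv_mul_cancel₀ hb.ne']
  · rw [inner_taylorVec_of_ne (by omega), mul_zero, mul_zero]

lemma taylorVec_eq_smul_wanderVec (hlam : (m : ℝ) / 2 < lam) (hmu : ∀ j, 0 < mu j) (l : ℕ) :
    taylorVec lam mu 0 l = ((√(normSeq lam mu l) : ℝ) : ℂ) • wanderVec lam mu l := by
  have hb : √(normSeq lam mu l) ≠ 0 := (Real.sqrt_pos.2 (normSeq_pos hlam hmu l)).ne'
  rw [wanderVec, smul_smul, ← ofReal_mul, mul_inv_cancel₀ hb, ofReal_one, one_smul]

lemma isWandering_wanderVec {l : ℕ} (hl : l ≤ m) : IsWandering lam mu (wanderVec lam mu l) := by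
  intro a b h
  rw [wanderVec, inner_smul_left, isWandering_taylorVec hl a b h, mul_zero]

lemma IsWandering.eq_sum (hlam : (m : ℝ) / 2 < lam) (hmu : ∀ j, 0 < mu j) {y : CoordSpace m}
    (hy : IsWandering lam mu y) :
    y = ∑ l : Fin (m + 1), inner ℂ (wanderVec lam mu l) y • wanderVec lam mu l := by
  rw [← sub_eq_zero]
  refine IsWandering.eq_zero hlam hmu (fun a b h => ?_) fun l hl => ?_
  · rw [inner_sub_left, hy a b h, sum_inner, Finset.sum_eq_zero, sub_zero]
    intro l _
    rw [inner_smul_left, isWandering_wanderVec (Nat.lt_succ_iff.1 l.2) a b h, mul_zero]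
  · rw [taylorVec_eq_smul_wanderVec hlam hmu, inner_smul_right, inner_sub_left, sum_inner,
      Finset.sum_eq_single (⟨l, by omega⟩ : Fin (m + 1))]
    · rw [inner_smul_left, inner_wanderVec hlam hmu]
      simp
    · intro p _ hp
      have hne : (p : ℕ) ≠ l := fun h => hp (Fin.ext h)
      rw [inner_smul_left, inner_wanderVec hlam hmu, if_neg hne, mul_zero]
    · simp

/-! ### Lifts -/

/-- `x` is the vector orthogonal to the wandering subspace which the adjoint of multiplication by
`z` maps to `y`. -/
def IsLift (lam : ℝ) (mu : Fin (m + 1) → ℝ) (y x : CoordSpace m) : Prop :=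
  (∀ a b, ShiftRel lam mu a b → inner ℂ x b = inner ℂ y a) ∧
    ∀ w, IsWandering lam mu w → inner ℂ w x = 0

/-- The difference of two lifts is wandering by the first clause and orthogonal to wandering vectors
by the second, hence orthogonal to itself. -/
lemma IsLift.unique {y x x' : CoordSpace m} (h : IsLift lam mu y x) (h' : IsLift lam mu y x') :
    x = x' := by
  have hw : IsWandering lam mu (x - x') := fun a b hab => by
    rw [inner_sub_left, h.1 a b hab, h'.1 a b hab, sub_self]
  rw [← sub_eq_zero, ← inner_self_eq_zero (𝕜 := ℂ), inner_sub_right, h.2 _ hw, h'.2 _ hw, sub_self]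

lemma IsLift.smul {y x : CoordSpace m} (c : ℂ) (h : IsLift lam mu y x) :
    IsLift lam mu (c • y) (c • x) :=
  ⟨fun a b hab => by rw [inner_smul_left, inner_smul_left, h.1 a b hab],
    fun w hw => by rw [inner_smul_right, h.2 w hw, mul_zero]⟩

lemma IsLift.sum {ι : Type*} {s : Finset ι} {y x : ι → CoordSpace m}
    (h : ∀ i ∈ s, IsLift lam mu (y i) (x i)) : IsLift lam mu (∑ i ∈ s, y i) (∑ i ∈ s, x i) :=
  ⟨fun a b hab => by
    rw [sum_inner, sum_inner]
    exact Finset.sum_congr rfl fun i hi => (h i hi).1 a b hab,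
    fun w hw => by
    rw [inner_sum]
    exact Finset.sum_eq_zero fun i hi => (h i hi).2 w hw⟩

/-- The `n`-fold lift of `taylorVec lam mu 0 p`. -/
def liftVec (lam : ℝ) (mu : Fin (m + 1) → ℝ) (n p : ℕ) : CoordSpace m :=
  ∑ q ∈ Finset.range (n + 1), if p + q ≤ m then
    (((-1) ^ q * (p + q).choose p * (normSeq lam mu p / normSeq lam mu (p + q)) : ℝ) : ℂ) •
      taylorVec lam mu (n - q) (p + q) else 0

lemma liftVec_zero (hlam : (m : ℝ) / 2 < lam) (hmu : ∀ j, 0 < mu j) {p : ℕ} (hp : p ≤ m) :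
    liftVec lam mu 0 p = taylorVec lam mu 0 p := by
  have := (normSeq_pos hlam hmu p).ne'
  simp [liftVec, hp, this]

lemma cast_choose_mul_choose (p q k : ℕ) :
    ((p + q).choose p : ℝ) * (p + k).choose (p + q) = (p + k).choose p * k.choose q := by
  have h := Nat.choose_mul (n := p + k) (Nat.le_add_right p q)
  rw [Nat.add_sub_cancel_left, Nat.add_sub_cancel_left] at h
  rw [mul_comm]
  exact_mod_cast h

/-- By degree only l = p + n matters. There the coefficients of `liftVec` are tuned so that the
weights b cancel and ∑ (-1)^q (n choose q) = 0 is left. -/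
lemma inner_taylorVec_zero_liftVec (hlam : (m : ℝ) / 2 < lam) (hmu : ∀ j, 0 < mu j) {n p l : ℕ}
    (hn : n ≠ 0) (hl : l ≤ m) :
    inner ℂ (taylorVec lam mu 0 l) (liftVec lam mu n p) = 0 := by
  rw [liftVec, inner_sum]
  by_cases hw : l = p + n
  · subst hw
    have hterm : ∀ q ∈ Finset.range (n + 1), inner ℂ (taylorVec lam mu 0 (p + n))
        (if p + q ≤ m then
          (((-1) ^ q * (p + q).choose p * (normSeq lam mu p / normSeq lam mu (p + q)) : ℝ) : ℂ) •
          taylorVec lam mu (n - q) (p + q) else 0) =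
        ((normSeq lam mu p * (p + n).choose p * ((-1) ^ q * n.choose q * 1) : ℝ) : ℂ) := by
      intro q hq
      rw [Finset.mem_range] at hq
      have hb := (normSeq_pos hlam hmu (p + q)).ne'
      rw [if_pos (by omega), inner_smul_right, ← inner_conj_symm,
        inner_taylorVec_zero hlam (by omega), conj_ofReal, ← ofReal_mul]
      congr 1
      have hc := cast_choose_mul_choose p q n
      field_simp
      linear_combination normSeq lam mu p * hc
    rw [Finset.sum_congr rfl hterm, ← ofReal_sum, ← Finset.mul_sum]
    have h0 := altDiff_const 1 hn 0
    rw [altDiff] at h0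
    rw [h0, mul_zero, ofReal_zero]
  · refine Finset.sum_eq_zero fun q hq => ?_
    rw [Finset.mem_range] at hq
    split_ifs
    · rw [inner_smul_right, inner_taylorVec_of_ne (by omega), mul_zero]
    · exact inner_zero_right _

/-- The adjoint of multiplication lowers the first index of each `taylorVec` by one and kills the
term with first index 0, which is q = n + 1. -/
lemma isLift_liftVec (hlam : (m : ℝ) / 2 < lam) (hmu : ∀ j, 0 < mu j) (n p : ℕ) :
    IsLift lam mu (liftVec lam mu n p) (liftVec lam mu (n + 1) p) := by
  refine ⟨fun a b hab => ?_, fun w hw => ?_⟩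
  · rw [liftVec, liftVec, Finset.sum_range_succ, inner_add_left, sum_inner, sum_inner,
      Nat.sub_self]
    have hlast : inner ℂ (if p + (n + 1) ≤ m then (((-1) ^ (n + 1) * (p + (n + 1)).choose p *
        (normSeq lam mu p / normSeq lam mu (p + (n + 1))) : ℝ) : ℂ) •
        taylorVec lam mu 0 (p + (n + 1)) else 0) b = 0 := by
      split_ifs with h
      · rw [inner_smul_left, (hab _ h).1, mul_zero]
      · exact inner_zero_left _
    rw [hlast, add_zero]
    refine Finset.sum_congr rfl fun q hq => ?_
    rw [Finset.mem_range] at hq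
    split_ifs with h
    · rw [inner_smul_left, inner_smul_left, show n + 1 - q = n - q + 1 by omega, (hab _ h).2]
    · rw [inner_zero_left, inner_zero_left]
  · rw [hw.eq_sum hlam hmu, sum_inner]
    refine Finset.sum_eq_zero fun l _ => ?_
    rw [inner_smul_left, wanderVec, inner_smul_left (taylorVec lam mu 0 l) (liftVec lam mu (n + 1) p),
      inner_taylorVec_zero_liftVec hlam hmu n.succ_ne_zero (Nat.lt_succ_iff.1 l.2), mul_zero,
      mul_zero]

/-! ### The curvature sequence -/

/-- The numbers `r² b_{r-1} / b_r` for `r ≤ m`, extended by zero. -/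
def ratioSeq (lam : ℝ) (mu : Fin (m + 1) → ℝ) (r : ℕ) : ℝ :=
  if r ≤ m then (r : ℝ) ^ 2 * normSeq lam mu (r - 1) / normSeq lam mu r else 0

/-- The diagonal entries of the curvature at the origin. -/
def curvSeq (lam : ℝ) (mu : Fin (m + 1) → ℝ) (p : ℕ) : ℝ :=
  2 * lam - m + 2 * p + (ratioSeq lam mu p - ratioSeq lam mu (p + 1))

lemma altDiff_add (c c' : ℕ → ℝ) (k p : ℕ) :
    altDiff (fun r => c r + c' r) k p = altDiff c k p + altDiff c' k p := by
  simp only [altDiff, mul_add, Finset.sum_add_distrib]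

/-- Both sides vanish for k ≥ 2, so only k = 0 and k = 1 carry content. The dependence on p + k and
the factor k + 1 are absorbed, turning the linear part of the Gram entry into a difference of one
fixed sequence. -/
lemma succ_mul_altDiff_linear (A : ℝ) (k p : ℕ) :
    (k + 1 : ℝ) * altDiff (fun r => A + p + k + r) k p = altDiff (fun r => A + 2 * r) k p := by
  rcases k with _ | _ | k
  · simp [altDiff]
    ring
  · simp [altDiff, Finset.sum_range_succ]
    ring
  · rw [altDiff_succ, altDiff_succ, altDiff_succ, altDiff_succ]
    simp only [altDiff, Finset.mul_sum]
    refine Finset.sum_congr rfl fun q _ => ?_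
    push_cast
    ring

lemma choose_mul_choose_pred {p q k : ℕ} (h : p + q ≠ 0) :
    ((p + q).choose p : ℝ) * (p + k).choose (p + q - 1) * (k + 1) =
      (p + k).choose p * (k + 1).choose q * (p + q) := by
  obtain ⟨r, hr⟩ : ∃ r, p + q = r + 1 := ⟨p + q - 1, by omega⟩
  have h1 : ((p + k : ℝ) + 1) * (p + k).choose (p + q - 1) =
      (p + (k + 1)).choose (p + q) * (p + q) := by
    have := Nat.add_one_mul_choose_eq (p + k) r
    rw [← hr] at this
    rw [show p + q - 1 = r by omega]
    exact_mod_cast this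
  have h2 := cast_choose_mul_choose p q (k + 1)
  have h3 : ((p + k).choose p : ℝ) * (p + k + 1) = (p + (k + 1)).choose p * (k + 1) := by
    have := Nat.choose_mul_succ_eq (p + k) p
    rw [show p + k + 1 - p = k + 1 by omega] at this
    exact_mod_cast this
  have h4 : (p + k + 1 : ℝ) ≠ 0 := by positivity
  refine mul_left_cancel₀ h4 ?_
  linear_combination ((p + q).choose p : ℝ) * (k + 1) * h1 + (k + 1) * (p + q : ℝ) * h2 -
    (k + 1).choose q * (p + q) * h3

lemma inner_taylorVec_one_liftVec (hlam : (m : ℝ) / 2 < lam) (hmu : ∀ j, 0 < mu j) {k p : ℕ}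
    (hk : p + k ≤ m) :
    inner ℂ (taylorVec lam mu 1 (p + k)) (liftVec lam mu (k + 1) p) =
      ((normSeq lam mu p * ((p + k).choose p / (k + 1)) * altDiff (curvSeq lam mu) k p : ℝ) : ℂ) := by
  have hterm : ∀ q ∈ Finset.range (k + 1 + 1), inner ℂ (taylorVec lam mu 1 (p + k))
      (if p + q ≤ m then
        (((-1) ^ q * (p + q).choose p * (normSeq lam mu p / normSeq lam mu (p + q)) : ℝ) : ℂ) •
        taylorVec lam mu (k + 1 - q) (p + q) else 0) =
      ((normSeq lam mu p * ((p + k).choose p / (k + 1)) *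
        ((k + 1) * ((-1) ^ q * k.choose q * (2 * lam - m + p + k + (p + q : ℕ))) +
          (-1) ^ q * (k + 1).choose q * ratioSeq lam mu (p + q)) : ℝ) : ℂ) := by
    intro q hq
    rw [Finset.mem_range] at hq
    split_ifs with h
    · rw [inner_smul_right, inner_taylorVec_one hlam (by omega), ← ofReal_mul]
      congr 1
      have hb := (normSeq_pos hlam hmu (p + q)).ne'
      have hc := cast_choose_mul_choose p q k
      rw [ratioSeq, if_pos h]
      by_cases h0 : p + q = 0
      · obtain rfl : p = 0 := by omega
        obtain rfl : q = 0 := by omega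
        simp only [add_zero, zero_add, Nat.cast_zero, Nat.choose_zero_right] at *
        push_cast
        field_simp
        ring
      · have hd := choose_mul_choose_pred (k := k) h0
        push_cast
        field_simp
        linear_combination ((2 * lam - m + p + q + (p + k)) * normSeq lam mu (p + q) *
          (k + 1) * normSeq lam mu p) * hc +
          (normSeq lam mu p * (p + q) * normSeq lam mu (p + q - 1)) * hd
    -- This can happen only for p + k = m; the convention that `ratioSeq` is zero beyond m makes the
    -- missing term fit the same formula.
    · have hq' : q = k + 1 := by omega
      subst hq'
      rw [inner_zero_right, ratioSeq, if_neg h, Nat.choose_succ_self]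
      simp
  rw [liftVec, inner_sum, Finset.sum_congr rfl hterm, ← ofReal_sum, ← Finset.mul_sum,
    Finset.sum_add_distrib, ← Finset.mul_sum]
  congr 2
  have e1 : altDiff (ratioSeq lam mu) (k + 1) p =
      ∑ q ∈ Finset.range (k + 1 + 1), (-1) ^ q * ((k + 1).choose q : ℝ) * ratioSeq lam mu (p + q) :=
    rfl
  rw [← e1, Finset.sum_range_succ, Nat.choose_succ_self]
  have e2 := succ_mul_altDiff_linear (2 * lam - m) k p
  rw [altDiff] at e2
  simp only [Nat.cast_zero, mul_zero, zero_mul, add_zero]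
  -- The (k + 1)-st difference of `ratioSeq` is the k-th difference of ρ_r - ρ_{r+1}, which joins
  -- the linear part to form `curvSeq`.
  rw [e2, altDiff_succ, ← altDiff_add]
  rfl

lemma inner_taylorVec_one_liftVec_of_ne {k p l : ℕ} (h : l ≠ p + k) :
    inner ℂ (taylorVec lam mu 1 l) (liftVec lam mu (k + 1) p) = 0 := by
  rw [liftVec, inner_sum]
  refine Finset.sum_eq_zero fun q hq => ?_
  rw [Finset.mem_range] at hq
  split_ifs
  · rw [inner_smul_right, inner_taylorVec_of_ne (by omega), mul_zero]
  · exact inner_zero_right _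

/-- The two vectors on the left differ by a multiple of a wandering vector, to which every proper
lift is orthogonal. -/
lemma inner_liftVec_one (hlam : (m : ℝ) / 2 < lam) (hmu : ∀ j, 0 < mu j) {k p l : ℕ}
    (hl : l ≤ m) :
    inner ℂ (liftVec lam mu 1 l) (liftVec lam mu (k + 1) p) =
      inner ℂ (taylorVec lam mu 1 l) (liftVec lam mu (k + 1) p) := by
  have hb := (normSeq_pos hlam hmu l).ne'
  conv_lhs => rw [liftVec]
  rw [Finset.sum_range_succ, Finset.sum_range_one, inner_add_left]
  have h2 : inner ℂ (if l + 1 ≤ m then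
      (((-1) ^ 1 * (l + 1).choose l * (normSeq lam mu l / normSeq lam mu (l + 1)) : ℝ) : ℂ) •
        taylorVec lam mu (1 - 1) (l + 1) else 0) (liftVec lam mu (k + 1) p) = 0 := by
    split_ifs with h
    · rw [inner_smul_left, inner_taylorVec_zero_liftVec hlam hmu k.succ_ne_zero h, mul_zero]
    · exact inner_zero_left _
  rw [h2, add_zero, if_pos (by omega)]
  simp [hb]

end Wandering

section Invariants

variable {m : ℕ} {lam lam' : ℝ} {mu mu' : Fin (m + 1) → ℝ}

/-! ### The invariant matrices -/

/-- The `n`-fold lift of `wanderVec lam mu l`. -/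
def normLift (lam : ℝ) (mu : Fin (m + 1) → ℝ) (n l : ℕ) : CoordSpace m :=
  (((√(normSeq lam mu l))⁻¹ : ℝ) : ℂ) • liftVec lam mu n l

/-- The matrix of the coefficient of `z ^ (k + 1) w̄` in the normalized kernel. -/
def liftMatrix (lam : ℝ) (mu : Fin (m + 1) → ℝ) (k : ℕ) : Matrix (Fin (m + 1)) (Fin (m + 1)) ℂ :=
  fun p l => inner ℂ (normLift lam mu (k + 1) p) (normLift lam mu 1 l)

lemma normLift_zero (hlam : (m : ℝ) / 2 < lam) (hmu : ∀ j, 0 < mu j) {l : ℕ} (hl : l ≤ m) :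
    normLift lam mu 0 l = wanderVec lam mu l := by
  rw [normLift, liftVec_zero hlam hmu hl, wanderVec]

lemma liftMatrix_of_ne (hlam : (m : ℝ) / 2 < lam) (hmu : ∀ j, 0 < mu j) (k : ℕ)
    (p l : Fin (m + 1)) (h : (l : ℕ) ≠ p + k) : liftMatrix lam mu k p l = 0 := by
  rw [liftMatrix, normLift, normLift, inner_smul_left, inner_smul_right, ← inner_conj_symm,
    inner_liftVec_one hlam hmu (Nat.lt_succ_iff.1 l.2), inner_taylorVec_one_liftVec_of_ne h]
  simp

lemma liftMatrix_of_eq (hlam : (m : ℝ) / 2 < lam) (hmu : ∀ j, 0 < mu j) (k : ℕ)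
    (p l : Fin (m + 1)) (h : (l : ℕ) = p + k) :
    liftMatrix lam mu k p l = (((√(normSeq lam mu p))⁻¹ * (√(normSeq lam mu l))⁻¹ *
      (normSeq lam mu p * (((p + k : ℕ)).choose p / (k + 1))) *
        altDiff (curvSeq lam mu) k p : ℝ) : ℂ) := by
  have hl := Nat.lt_succ_iff.1 l.2
  rw [liftMatrix, normLift, normLift, inner_smul_left, inner_smul_right, ← inner_conj_symm,
    inner_liftVec_one hlam hmu hl, h, inner_taylorVec_one_liftVec hlam hmu (by omega)]
  simp only [conj_ofReal, ← ofReal_mul]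
  congr 1
  ring

lemma liftMatrix_zero_self (hlam : (m : ℝ) / 2 < lam) (hmu : ∀ j, 0 < mu j) (p : Fin (m + 1)) :
    liftMatrix lam mu 0 p p = (curvSeq lam mu p : ℂ) := by
  have hb := normSeq_pos hlam hmu p
  rw [liftMatrix_of_eq hlam hmu 0 p p rfl]
  congr 1
  rw [← mul_inv, Real.mul_self_sqrt hb.le]
  simp [altDiff, hb.ne']

lemma ratioSeq_zero : ratioSeq lam mu 0 = 0 := by simp [ratioSeq]

lemma ratioSeq_succ_self : ratioSeq lam mu (m + 1) = 0 := by simp [ratioSeq]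

lemma ratioSeq_pos (hlam : (m : ℝ) / 2 < lam) (hmu : ∀ j, 0 < mu j) {r : ℕ} (hr : r ≠ 0)
    (hrm : r ≤ m) : 0 < ratioSeq lam mu r := by
  have h1 := normSeq_pos hlam hmu r
  have h2 := normSeq_pos hlam hmu (r - 1)
  rw [ratioSeq, if_pos hrm]
  positivity

/-- The end values are 2λ - m - ρ_1 and 2λ + m + ρ_m, and both ρ_1 and ρ_m are positive as m ≥ 1. -/
lemma curvSeq_zero_ne (hm : 1 ≤ m) (hlam : (m : ℝ) / 2 < lam) (hmu : ∀ j, 0 < mu j) :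
    curvSeq lam mu 0 ≠ curvSeq lam mu m := by
  have h1 := ratioSeq_pos hlam hmu one_ne_zero hm
  have h2 := ratioSeq_pos hlam hmu (r := m) (by omega) le_rfl
  refine ne_of_lt ?_
  rw [curvSeq, curvSeq, ratioSeq_zero, ratioSeq_succ_self, zero_add, Nat.cast_zero]
  have : (0 : ℝ) ≤ m := Nat.cast_nonneg m
  linarith

lemma liftMatrix_connected (hm : 1 ≤ m) (hlam : (m : ℝ) / 2 < lam) (hmu : ∀ j, 0 < mu j)
    (X : Fin (m + 1) → ℂ)
    (hX : ∀ k, ∀ i j : Fin (m + 1), liftMatrix lam mu k i j ≠ 0 → X i = X j)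
    (i j : Fin (m + 1)) : X i = X j := by
  set Y : ℕ → ℂ := fun n => if h : n < m + 1 then X ⟨n, h⟩ else 0
  have hYX : ∀ i : Fin (m + 1), Y i = X i := fun i => dif_pos i.2
  have key : ∀ l ≤ m, Y l = Y 0 := fun l hl => by
    refine eq_of_altDiff_ne_zero (curvSeq_zero_ne hm hlam hmu) (fun k p hpk hne => ?_) hl
    have h1 := hX k ⟨p, by omega⟩ ⟨p + k, by omega⟩ (by
      rw [liftMatrix_of_eq hlam hmu k _ _ rfl]
      have h1 := Real.sqrt_pos.2 (normSeq_pos hlam hmu p)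
      have h2 := Real.sqrt_pos.2 (normSeq_pos hlam hmu (p + k))
      have h3 := normSeq_pos hlam hmu p
      have h4 : (0 : ℝ) < (p + k).choose p := by exact_mod_cast Nat.choose_pos (by omega)
      rw [ofReal_ne_zero]
      refine mul_ne_zero (ne_of_gt ?_) hne
      simp only
      positivity)
    rw [← hYX, ← hYX] at h1
    exact h1
  rw [← hYX, ← hYX, key i (Nat.lt_succ_iff.1 i.2), key j (Nat.lt_succ_iff.1 j.2)]

/-! ### Intertwining unitary maps -/

section Intertwiner

variable {W : CoordSpace m ≃ₗᵢ[ℂ] CoordSpace m}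

lemma IsWandering.map (hW : ∀ a b, ShiftRel lam mu a b ↔ ShiftRel lam' mu' (W a) (W b))
    {y : CoordSpace m} (hy : IsWandering lam mu y) : IsWandering lam' mu' (W y) := by
  intro a b hab
  obtain ⟨a, rfl⟩ := W.surjective a
  obtain ⟨b, rfl⟩ := W.surjective b
  rw [W.inner_map_map]
  exact hy a b ((hW a b).2 hab)

lemma IsLift.map (hW : ∀ a b, ShiftRel lam mu a b ↔ ShiftRel lam' mu' (W a) (W b))
    {y x : CoordSpace m} (h : IsLift lam mu y x) : IsLift lam' mu' (W y) (W x) := by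
  refine ⟨fun a b hab => ?_, fun w hw => ?_⟩
  · obtain ⟨a, rfl⟩ := W.surjective a
    obtain ⟨b, rfl⟩ := W.surjective b
    rw [W.inner_map_map, W.inner_map_map]
    exact h.1 a b ((hW a b).2 hab)
  · obtain ⟨w, rfl⟩ := W.surjective w
    rw [W.inner_map_map]
    refine h.2 w fun a b hab => ?_
    rw [← W.inner_map_map]
    exact hw _ _ ((hW a b).1 hab)

/-- The matrix of `W` between the wandering subspaces. -/
def wanderMatrix (lam : ℝ) (mu : Fin (m + 1) → ℝ) (lam' : ℝ) (mu' : Fin (m + 1) → ℝ)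
    (W : CoordSpace m ≃ₗᵢ[ℂ] CoordSpace m) : Matrix (Fin (m + 1)) (Fin (m + 1)) ℂ :=
  fun p l => inner ℂ (wanderVec lam' mu' p) (W (wanderVec lam mu l))

/-- The same matrix V serves for every n: lifting is linear, unique and preserved by W, so the
expansion of the wandering vectors propagates by induction. -/
lemma map_normLift (hlam : (m : ℝ) / 2 < lam) (hlam' : (m : ℝ) / 2 < lam')
    (hmu : ∀ j, 0 < mu j) (hmu' : ∀ j, 0 < mu' j)
    (hW : ∀ a b, ShiftRel lam mu a b ↔ ShiftRel lam' mu' (W a) (W b)) (n : ℕ)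
    (l : Fin (m + 1)) : W (normLift lam mu n l) =
      ∑ p : Fin (m + 1), wanderMatrix lam mu lam' mu' W p l • normLift lam' mu' n p := by
  induction n with
  | zero =>
    have hl := fun l : Fin (m + 1) => Nat.lt_succ_iff.1 l.2
    simp only [normLift_zero hlam hmu (hl _), normLift_zero hlam' hmu' (hl _)]
    exact ((isWandering_wanderVec (hl l)).map hW).eq_sum hlam' hmu'
  | succ n ih =>
    have h1 := ((isLift_liftVec hlam hmu n l).smul
      (((√(normSeq lam mu l))⁻¹ : ℝ) : ℂ)).map hW
    have h2 : IsLift lam' mu'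
        (∑ p : Fin (m + 1), wanderMatrix lam mu lam' mu' W p l • normLift lam' mu' n p)
        (∑ p : Fin (m + 1), wanderMatrix lam mu lam' mu' W p l • normLift lam' mu' (n + 1) p) :=
      IsLift.sum fun p _ => ((isLift_liftVec hlam' hmu' n p).smul _).smul _
    rw [← ih] at h2
    exact h1.unique h2

lemma conjTranspose_mul_gram_mul {ι E : Type*} [Fintype ι] [NormedAddCommGroup E]
    [InnerProductSpace ℂ E] (V : Matrix ι ι ℂ) (x y : ι → E) (p l : ι) :
    inner ℂ (∑ i, V i p • x i) (∑ j, V j l • y j) =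
      (V.conjTranspose * Matrix.of (fun i j => inner ℂ (x i) (y j)) * V) p l := by
  simp only [sum_inner, inner_sum, inner_smul_left, inner_smul_right, Matrix.mul_apply,
    Matrix.conjTranspose_apply, Matrix.of_apply, Finset.sum_mul, Finset.mul_sum]
  refine Finset.sum_congr rfl fun j _ => Finset.sum_congr rfl fun i _ => ?_
  rw [Complex.star_def]
  ring

/-- Intertwined multiplication operators have the same curvature sequence. -/
lemma curvSeq_eq (hm : 1 ≤ m) (hlam : (m : ℝ) / 2 < lam) (hlam' : (m : ℝ) / 2 < lam')
    (hmu : ∀ j, 0 < mu j) (hmu' : ∀ j, 0 < mu' j)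
    (hW : ∀ a b, ShiftRel lam mu a b ↔ ShiftRel lam' mu' (W a) (W b)) {l : ℕ} (hl : l ≤ m) :
    curvSeq lam mu l = curvSeq lam' mu' l := by
  set V := wanderMatrix lam mu lam' mu' W with hVdef
  have hmap := map_normLift hlam hlam' hmu hmu' hW
  have hle := fun l : Fin (m + 1) => Nat.lt_succ_iff.1 l.2
  have hV : V.conjTranspose * V = 1 := by
    ext p q
    have h1 := conjTranspose_mul_gram_mul V (fun i : Fin (m + 1) => normLift lam' mu' 0 i)
      (fun i : Fin (m + 1) => normLift lam' mu' 0 i) p q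
    rw [← hmap, ← hmap, W.inner_map_map, normLift_zero hlam hmu (hle _),
      normLift_zero hlam hmu (hle _), inner_wanderVec hlam hmu] at h1
    have h2 : Matrix.of (fun i j : Fin (m + 1) =>
        inner ℂ (normLift lam' mu' 0 i) (normLift lam' mu' 0 j)) = 1 := by
      ext i j
      rw [Matrix.of_apply, normLift_zero hlam' hmu' (hle _), normLift_zero hlam' hmu' (hle _),
        inner_wanderVec hlam' hmu', Matrix.one_apply]
      simp [Fin.ext_iff]
    rw [h2, Matrix.mul_one] at h1
    rw [← h1, Matrix.one_apply]
    simp [Fin.ext_iff]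
  have hG : ∀ k, V.conjTranspose * liftMatrix lam' mu' k * V = liftMatrix lam mu k := by
    intro k
    ext p q
    have h1 := conjTranspose_mul_gram_mul V (fun i : Fin (m + 1) => normLift lam' mu' (k + 1) i)
      (fun i : Fin (m + 1) => normLift lam' mu' 1 i) p q
    rw [← hmap, ← hmap, W.inner_map_map] at h1
    exact h1.symm
  have hdiag : ∀ i j, i ≠ j → V i j = 0 := fun i j hij =>
    diagonal_of_intertwines hV (liftMatrix lam mu) (liftMatrix lam' mu')
      (liftMatrix_of_ne hlam hmu) (liftMatrix_of_ne hlam' hmu') hG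
      (liftMatrix_connected hm hlam hmu) hij
  set q : Fin (m + 1) := ⟨l, by omega⟩
  have h1 := congrFun (congrFun hV q) q
  have h2 := congrFun (congrFun (hG 0) q) q
  -- For diagonal V, unitarity says that V q q has modulus 1, so conjugation by V leaves the
  -- diagonal entries of `liftMatrix` at k = 0 unchanged.
  rw [Matrix.mul_apply, Finset.sum_eq_single q (fun i _ hi => by rw [hdiag i q hi, mul_zero])
    (by simp), Matrix.one_apply_eq] at h1
  rw [Matrix.mul_apply, Finset.sum_eq_single q (fun i _ hi => by rw [hdiag i q hi, mul_zero])
    (by simp), Matrix.mul_apply, Finset.sum_eq_single q (fun i _ hi => by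
      rw [Matrix.conjTranspose_apply, hdiag i q hi, star_zero, zero_mul])
    (by simp), liftMatrix_zero_self hlam hmu, liftMatrix_zero_self hlam' hmu', mul_right_comm,
    h1, one_mul] at h2
  exact_mod_cast h2.symm

end Intertwiner

/-! ### Recovering the parameters -/

/-- The ρ terms telescope and both ends ρ_0 and ρ_{m+1} are zero, so the trace sees λ but not μ. -/
lemma sum_curvSeq : ∑ p ∈ Finset.range (m + 1), curvSeq lam mu p =
    (m + 1) * (2 * lam - m) + ∑ p ∈ Finset.range (m + 1), 2 * (p : ℝ) := by
  simp only [curvSeq, Finset.sum_add_distrib, Finset.sum_range_sub', ratioSeq_zero,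
    ratioSeq_succ_self]
  simp
  ring

lemma normSeq_zero (h0 : mu 0 = 1) : normSeq lam mu 0 = 1 := by
  rw [normSeq, Finset.sum_eq_single 0]
  · simp [h0, poch]
  · intro j _ hj
    have : (j : ℕ) ≠ 0 := fun h => hj (Fin.ext h)
    simp [Nat.choose_eq_zero_of_lt (Nat.pos_of_ne_zero this)]
  · simp

lemma lam_eq_of_curvSeq_eq (h : ∀ l ≤ m, curvSeq lam mu l = curvSeq lam' mu' l) : lam = lam' := by
  have h1 : ∑ p ∈ Finset.range (m + 1), curvSeq lam mu p =
      ∑ p ∈ Finset.range (m + 1), curvSeq lam' mu' p :=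
    Finset.sum_congr rfl fun p hp => h p (Nat.lt_succ_iff.1 (Finset.mem_range.1 hp))
  rw [sum_curvSeq, sum_curvSeq, add_left_inj] at h1
  have h2 := mul_left_cancel₀ (by positivity : (m + 1 : ℝ) ≠ 0) h1
  linarith

lemma ratioSeq_eq (h : ∀ l ≤ m, curvSeq lam mu l = curvSeq lam mu' l) {r : ℕ} (hr : r ≤ m) :
    ratioSeq lam mu r = ratioSeq lam mu' r := by
  induction r with
  | zero => rw [ratioSeq_zero, ratioSeq_zero]
  | succ r ih =>
    have h1 := h r (by omega)
    rw [curvSeq, curvSeq, ih (by omega)] at h1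
    linarith

lemma normSeq_eq (hlam : (m : ℝ) / 2 < lam) (hmu : ∀ j, 0 < mu j) (hmu' : ∀ j, 0 < mu' j)
    (h0 : mu 0 = 1) (h0' : mu' 0 = 1)
    (h : ∀ l ≤ m, curvSeq lam mu l = curvSeq lam mu' l) {r : ℕ} (hr : r ≤ m) :
    normSeq lam mu r = normSeq lam mu' r := by
  induction r with
  | zero => rw [normSeq_zero h0, normSeq_zero h0']
  | succ r ih =>
    have h1 := ratioSeq_eq h hr
    have hb := (normSeq_pos hlam hmu (r + 1)).ne'
    have hb' := (normSeq_pos hlam hmu' (r + 1)).ne'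
    have hr' := (normSeq_pos hlam hmu' r).ne'
    rw [ratioSeq, ratioSeq, if_pos hr, if_pos hr, Nat.add_sub_cancel, ih (by omega),
      div_eq_div_iff hb hb'] at h1
    have hne : ((r + 1 : ℕ) : ℝ) ^ 2 * normSeq lam mu' r ≠ 0 := mul_ne_zero (by positivity) hr'
    exact (mul_left_cancel₀ hne h1).symm

/-- Triangularity: `normSeq` at r involves only μ_j with j ≤ r, and μ_r² enters with coefficient 1.
-/
lemma mu_eq_of_normSeq_eq (hmu : ∀ j, 0 < mu j) (hmu' : ∀ j, 0 < mu' j)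
    (h : ∀ r ≤ m, normSeq lam mu r = normSeq lam mu' r) : mu = mu' := by
  have key : ∀ r : ℕ, ∀ j : Fin (m + 1), (j : ℕ) = r → mu j = mu' j := by
    intro r
    induction r using Nat.strong_induction_on with
    | _ r ih =>
      rintro j rfl
      have h1 := sub_eq_zero.2 (h j (Nat.lt_succ_iff.1 j.2))
      rw [normSeq, normSeq, ← Finset.sum_sub_distrib, Finset.sum_eq_single j] at h1
      · simp [poch, sub_eq_zero] at h1
        exact (sq_eq_sq₀ (hmu j).le (hmu' j).le).1 h1
      · intro i _ hi
        rcases lt_or_gt_of_ne hi with hlt | hgt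
        · rw [ih i hlt i rfl, sub_self]
        · simp [Nat.choose_eq_zero_of_lt (show (j : ℕ) < i from hgt)]
      · simp
  funext j
  exact key j j rfl

end Invariants

end HomogeneousShift

end

theorem mainTheorem2 (m : ℕ) (hm : 1 ≤ m)
    (lam lam' : ℝ) (hlam : (m : ℝ) / 2 < lam) (hlam' : (m : ℝ) / 2 < lam')
    (mu mu' : Fin (m + 1) → ℝ) (hmu : ∀ j, 0 < mu j) (hmu' : ∀ j, 0 < mu' j)
    (hmu0 : mu 0 = 1) (hmu0' : mu' 0 = 1)
    (h : HomogeneousShift.UnitarilyEquivalent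
      (HomogeneousShift.mulOp hlam hmu) (HomogeneousShift.mulOp hlam' hmu')) :
    lam = lam' ∧ mu = mu' := by
  obtain ⟨W, hW⟩ := h.exists_coord
  have hc : ∀ l ≤ m, HomogeneousShift.curvSeq lam mu l = HomogeneousShift.curvSeq lam' mu' l :=
    fun l hl => HomogeneousShift.curvSeq_eq hm hlam hlam' hmu hmu' hW hl
  obtain rfl := HomogeneousShift.lam_eq_of_curvSeq_eq hc
  exact ⟨rfl, HomogeneousShift.mu_eq_of_normSeq_eq hmu hmu' fun r hr =>
    HomogeneousShift.normSeq_eq hlam hmu hmu' hmu0 hmu0' hc hr⟩
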